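/- For an oriented link $L$ let $P_L(v,z)\in\mathbb Z[v^{\pm1},z^{\pm1}]$ be its Homfly polynomial, that is, the oriented link invariant determined by $P_{\text{unknot}}=1$ and the skein relation \[ v^{-1}P_{L_+}-v\,P_{L_-}=z\,P_{L_0}, \] where $L_+,L_-,L_0$ agree outside a ball in which they are a positive crossing, a negative crossing and the oriented smoothing of the crossing. (Equivalently, $P_D=v^{w}H_D$, where $w$ is the writhe of a diagram $D$ of $L$ and $H$ is the framed Homfly polynomial.) The left (respectively right) column of a non-zero Laurent polynomial in $v$ and $z$ is the coefficient, a Laurent polynomial in $z$, of the lowest (respectively highest) power of $v$ that occurs in it. Let $n\ge 1$, let $B_n$ be the braid group on $n$ strands with standard (positive) generators $\sigma_1,\dots,\sigma_{n-1}$, let $\Delta\in B_n$ be the Garside half twist, and let $\widehat\beta$ denote the closure of a braid $\beta$, oriented by its strands. Let $\beta\in B_n$ be a positive braid, i.e. a product of generators $\sigma_i$ without inverses (the empty product is allowed). Then $P_{\widehat\beta}$ and $P_{\widehat{\beta\Delta^2}}$ are non-zero, and \[ \text{left column of }P_{\widehat\beta}=(-1)^{n-1}\cdot\text{right column of }P_{\widehat{\beta\Delta^2}}.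 \] -/

import Mathlib

/-! ### Braid groups -/

/-- Artin's relations between the standard generators `σ_0, …, σ_{n-2}` on `n` strands. -/
def braidRelations (n : ℕ) : Set (FreeGroup (Fin (n - 1))) :=
  {r | (∃ i j : Fin (n - 1), (i : ℕ) + 1 = j ∧
        r = (FreeGroup.of i * FreeGroup.of j * FreeGroup.of i) *
          (FreeGroup.of j * FreeGroup.of i * FreeGroup.of j)⁻¹) ∨
      (∃ i j : Fin (n - 1), (i : ℕ) + 1 < j ∧
        r = (FreeGroup.of i * FreeGroup.of j) * (FreeGroup.of j * FreeGroup.of i)⁻¹)}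

/-- The braid group on `n` strands, by Artin's presentation. -/
abbrev BraidGroup (n : ℕ) : Type := PresentedGroup (braidRelations n)

namespace BraidGroup

/-- The standard (positive) generator `σ_i`, crossing the strands `i` and `i + 1`, numbered
from `0`. -/
def σ {n : ℕ} (i : Fin (n - 1)) : BraidGroup n := PresentedGroup.of i

theorem σ_braid {n : ℕ} {i j : Fin (n - 1)} (h : (i : ℕ) + 1 = j) :
    (σ i * σ j * σ i : BraidGroup n) = σ j * σ i * σ j :=
  mul_inv_eq_one.mp ((PresentedGroup.one_of_mem (rels := braidRelations n))
    (Or.inl ⟨i, j, h, rfl⟩))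

theorem σ_comm {n : ℕ} {i j : Fin (n - 1)} (h : (i : ℕ) + 1 < j) :
    (σ i * σ j : BraidGroup n) = σ j * σ i :=
  mul_inv_eq_one.mp ((PresentedGroup.one_of_mem (rels := braidRelations n))
    (Or.inr ⟨i, j, h, rfl⟩))

/-- A braid is positive if it is represented by a word in the `σ_i` without inverses. -/
def IsPositive {n : ℕ} (β : BraidGroup n) : Prop :=
  β ∈ Submonoid.closure (Set.range (σ : Fin (n - 1) → BraidGroup n))

/-- The homomorphism which adds a trivial strand after the last one. -/
def addStrand (n : ℕ) : BraidGroup n →* BraidGroup (n + 1) :=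
  PresentedGroup.toGroup (f := fun i : Fin (n - 1) =>
      (σ ⟨i, by omega⟩ : BraidGroup (n + 1))) (by
    rintro r (⟨i, j, h, rfl⟩ | ⟨i, j, h, rfl⟩)
    · simp only [map_mul, map_inv, FreeGroup.lift_apply_of]
      exact mul_inv_eq_one.mpr (σ_braid h)
    · simp only [map_mul, map_inv, FreeGroup.lift_apply_of]
      exact mul_inv_eq_one.mpr (σ_comm h))

theorem addStrand_σ {n : ℕ} (i : Fin (n - 1)) :
    addStrand n (σ i) = σ ⟨i, by omega⟩ :=
  PresentedGroup.toGroup.of _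

/-- The Garside half twist `Δ_n`, given by `Δ_{n+1} = (σ_0 σ_1 ⋯ σ_{n-1}) Δ_n`. -/
def garside : (n : ℕ) → BraidGroup n
  | 0 => 1
  | n + 1 => (List.ofFn fun i : Fin n => σ (n := n + 1) i).prod * addStrand n (garside n)

theorem induction_generators {n : ℕ} {C : BraidGroup n → Prop} (hσ : ∀ i, C (σ i)) (h1 : C 1)
    (hmul : ∀ α β, C α → C β → C (α * β)) (hinv : ∀ α, C α → C α⁻¹) (β : BraidGroup n) : C β :=
  PresentedGroup.generated_by (braidRelations n)
    { carrier := {β | C β}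
      mul_mem' := fun {a b} ha hb => hmul a b ha hb
      one_mem' := h1
      inv_mem' := fun {a} ha => hinv a ha } hσ β

end BraidGroup

/-! ### Closed braids and oriented links -/

/-- A braid on at least one strand, considered as representing its closure. -/
structure ClosedBraid where
  strands : ℕ
  pos : 0 < strands
  braid : BraidGroup strands

/-- The Markov moves: conjugation, and positive and negative (de)stabilization. -/
inductive MarkovMove : ClosedBraid → ClosedBraid → Prop
  | conj {n : ℕ} (hn : 0 < n) (α β : BraidGroup n) :
      MarkovMove ⟨n, hn, α * β⟩ ⟨n, hn, β * α⟩
  | stabPos {n : ℕ} (hn : 0 < n) (α : BraidGroup n) :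
      MarkovMove ⟨n + 1, n.succ_pos, BraidGroup.addStrand n α *
        BraidGroup.σ ⟨n - 1, by omega⟩⟩ ⟨n, hn, α⟩
  | stabNeg {n : ℕ} (hn : 0 < n) (α : BraidGroup n) :
      MarkovMove ⟨n + 1, n.succ_pos, BraidGroup.addStrand n α *
        (BraidGroup.σ ⟨n - 1, by omega⟩)⁻¹⟩ ⟨n, hn, α⟩

/-- Oriented link types in 3-space. By the theorems of Alexander and Markov every (non-empty)
oriented link is the closure of a braid, and two braids have isotopic closures exactly when they
are connected by Markov moves and their inverses. -/
def OrientedLink : Type := Quot MarkovMove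

/-- The closure of a braid, oriented by its strands. -/
def BraidGroup.closure {n : ℕ} (hn : 0 < n) (β : BraidGroup n) : OrientedLink :=
  Quot.mk MarkovMove ⟨n, hn, β⟩

/-! ### Laurent polynomials in `v` and `z` and their columns -/

/-- `ℤ[z^{±1}][v^{±1}]`. -/
abbrev LaurentVZ : Type := LaurentPolynomial (LaurentPolynomial ℤ)

namespace LaurentVZ

noncomputable section

/-- The monomial `v ^ k`. -/
def v (k : ℤ) : LaurentVZ := LaurentPolynomial.T k

/-- The monomial `z ^ k`. -/
def z (k : ℤ) : LaurentVZ := LaurentPolynomial.C (LaurentPolynomial.T k)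

/-- The column of `P` at `v ^ k`: the coefficient of `v ^ k`, a Laurent polynomial in `z`. -/
def column (P : LaurentVZ) (k : ℤ) : LaurentPolynomial ℤ := P.coeff k

/-- The left column of `P`: the coefficient of the lowest power of `v` that occurs in `P`
(and `0` if `P = 0`). -/
def leftColumn (P : LaurentVZ) : LaurentPolynomial ℤ :=
  if h : P.coeff.support.Nonempty then P.column (P.coeff.support.min' h) else 0

/-- The right column of `P`: the coefficient of the highest power of `v` that occurs in `P`
(and `0` if `P = 0`). -/
def rightColumn (P : LaurentVZ) : LaurentPolynomial ℤ :=
  if h : P.coeff.support.Nonempty then P.column (P.coeff.support.max' h) else 0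

end

end LaurentVZ

/-! ### The Homfly polynomial -/

/-- The defining properties of the Homfly polynomial as an invariant of oriented links: it is `1`
on the unknot, and `v⁻¹ P(L₊) - v P(L₋) = z P(L₀)` for every three links `L₊, L₋, L₀` that agree
outside a ball, in which they are a positive crossing, a negative crossing and its smoothing.
(Every such triple is given by the closures of `α σ_i β`, `α σ_i⁻¹ β` and `α β` for some braids
`α` and `β`.) -/
structure IsHomfly (P : OrientedLink → LaurentVZ) : Prop where
  unknot : P (BraidGroup.closure Nat.one_pos (1 : BraidGroup 1)) = 1
  skein : ∀ {n : ℕ} (hn : 0 < n) (α β : BraidGroup n) (i : Fin (n - 1)),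
    LaurentVZ.v (-1) * P (BraidGroup.closure hn (α * BraidGroup.σ i * β)) -
      LaurentVZ.v 1 * P (BraidGroup.closure hn (α * (BraidGroup.σ i)⁻¹ * β)) =
      LaurentVZ.z 1 * P (BraidGroup.closure hn (α * β))

/-! ### Existence of the Homfly polynomial

The function is constructed as the normalized trace on the Hecke algebras of the symmetric groups.
The Hecke algebra on `n + 1` strands is a free module over the Hecke algebra on `n` strands with
one basis element for each position of the last strand; so all of them act on `Space R`,
where an index `p :: c` records the position `p` of the last strand and recursively those of the
others. -/

namespace HomflyTrace

variable {R : Type*} [CommRing R]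

abbrev Space (R : Type*) := List ℕ → R × R

/-- The component at position `p` of the last strand. -/
def slice (p : ℕ) : Space R →ₗ[R] Space R where
  toFun f := fun c => f (p :: c)
  map_add' _ _ := rfl
  map_smul' _ _ := rfl

theorem eq_of_slice {f g : Space R} {p : ℕ} {c : List ℕ}
    (h : slice (R := R) p f c = slice (R := R) p g c) : f (p :: c) = g (p :: c) := h

/-- Right multiplication by the generator `g_j`, where `g_j² = z g_j + 1`. -/
def rhoFun (z : R) : List ℕ → ℕ → Space R → R × R
  | [], _, f => (z * (f []).1 + (f []).2, (f []).1)
  | p :: c, j, f =>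
    if j + 1 < p then rhoFun z c j (slice p f)
    else if p = j + 1 then f (j :: c)
    else if p = j then f ((j + 1) :: c) + z • f (j :: c)
    else rhoFun z c (j - 1) (slice p f)

theorem rhoFun_add (z : R) (c : List ℕ) : ∀ (j : ℕ) (f g : Space R),
    rhoFun z c j (f + g) = rhoFun z c j f + rhoFun z c j g := by
  induction c with
  | nil =>
    intro j f g
    ext <;> simp [rhoFun]
    ring
  | cons p c ih =>
    intro j f g
    simp only [rhoFun, map_add, ih]
    split_ifs <;> simp
    abel

theorem rhoFun_smul (z : R) (c : List ℕ) : ∀ (j : ℕ) (a : R) (f : Space R),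
    rhoFun z c j (a • f) = a • rhoFun z c j f := by
  induction c with
  | nil =>
    intro j a f
    ext <;> simp [rhoFun]
    ring
  | cons p c ih =>
    intro j a f
    simp only [rhoFun, map_smul, ih]
    split_ifs <;> simp [smul_comm z a]

def rho (z : R) (j : ℕ) : Space R →ₗ[R] Space R where
  toFun f := fun c => rhoFun z c j f
  map_add' f g := funext fun c => rhoFun_add z c j f g
  map_smul' a f := funext fun c => rhoFun_smul z c j a f

variable (z : R)

theorem rho_nil (j : ℕ) (f : Space R) :
    rho z j f [] = (z * (f []).1 + (f []).2, (f []).1) := rfl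

theorem rho_far {j p : ℕ} (f : Space R) (h : j + 1 < p) :
    slice p (rho z j f) = rho z j (slice p f) := by
  funext c; simp [slice, rho, rhoFun, h]

theorem rho_succ (j : ℕ) (f : Space R) : slice (j + 1) (rho z j f) = slice j f := by
  funext c; simp [slice, rho, rhoFun]

theorem rho_self (j : ℕ) (f : Space R) :
    slice j (rho z j f) = slice (j + 1) f + z • slice j f := by
  funext c; simp [slice, rho, rhoFun]

theorem rho_low {j p : ℕ} (f : Space R) (h : p < j) :
    slice p (rho z j f) = rho z (j - 1) (slice p f) := by
  have h1 : ¬ j + 1 < p := by omega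
  have h2 : ¬ p = j + 1 := by omega
  have h3 : ¬ p = j := by omega
  funext c; simp [slice, rho, rhoFun, h1, h2, h3]

theorem rho_sq_aux (c : List ℕ) : ∀ (j : ℕ) (f : Space R),
    rho z j (rho z j f) c = (z • rho z j f + f) c := by
  induction c with
  | nil => intro j f; ext <;> simp [rho_nil]
  | cons p c ih =>
    intro j f
    apply eq_of_slice
    rw [map_add, map_smul]
    rcases lt_trichotomy p j with h | rfl | h
    · rw [rho_low z _ h, rho_low z _ h, ih]
    · rw [rho_self, rho_self, rho_succ, add_comm]
    · rcases Nat.lt_or_ge (j + 1) p with h' | h'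
      · rw [rho_far z _ h', rho_far z _ h', ih]
      · obtain rfl : p = j + 1 := by omega
        rw [rho_succ, rho_succ, rho_self, add_comm]

theorem rho_sq (j : ℕ) (f : Space R) : rho z j (rho z j f) = z • rho z j f + f :=
  funext fun c => rho_sq_aux z c j f

theorem rho_comm_aux (c : List ℕ) : ∀ (i j : ℕ) (_ : i + 1 < j) (f : Space R),
    rho z i (rho z j f) c = rho z j (rho z i f) c := by
  induction c with
  | nil => intro i j _ f; rfl
  | cons p c ih =>
    intro i j h f
    apply eq_of_slice
    rcases lt_trichotomy p i with h1 | rfl | h1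
    · rw [rho_low z _ h1, rho_low z _ (by omega), rho_low z _ (by omega), rho_low z _ h1,
        ih _ _ (by omega)]
    · rw [rho_self, rho_low z _ (by omega), rho_low z _ (by omega), rho_low z _ (by omega),
        rho_self, map_add, map_smul]
    · rcases Nat.lt_or_ge (i + 1) p with h2 | h2
      · rw [rho_far z _ h2]
        rcases lt_trichotomy p j with h3 | rfl | h3
        · rw [rho_low z _ h3, rho_low z _ h3, rho_far z _ h2, ih _ _ (by omega)]
        · rw [rho_self, rho_self, rho_far z _ h2, rho_far z _ (by omega), map_add, map_smul]
        · rcases Nat.lt_or_ge (j + 1) p with h4 | h4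
          · rw [rho_far z _ h4, rho_far z _ h4, rho_far z _ h2, ih _ _ h]
          · obtain rfl : p = j + 1 := by omega
            rw [rho_succ, rho_succ, rho_far z _ (by omega)]
      · obtain rfl : p = i + 1 := by omega
        rw [rho_succ, rho_low z _ (by omega), rho_low z _ (by omega), rho_succ]

theorem rho_comm {i j : ℕ} (h : i + 1 < j) (f : Space R) :
    rho z i (rho z j f) = rho z j (rho z i f) :=
  funext fun c => rho_comm_aux z c i j h f

theorem rho_braid_aux (c : List ℕ) : ∀ (j : ℕ) (f : Space R),
    rho z j (rho z (j + 1) (rho z j f)) c = rho z (j + 1) (rho z j (rho z (j + 1) f)) c := by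
  induction c with
  | nil => intro j f; rfl
  | cons p c ih =>
    intro j f
    apply eq_of_slice
    rcases lt_trichotomy p j with h1 | rfl | h1
    · obtain ⟨i, rfl⟩ : ∃ i, j = i + 1 := ⟨j - 1, by omega⟩
      simp only [rho_low z _ h1, rho_low z _ (show p < i + 1 + 1 by omega)]
      exact ih i _
    · simp only [rho_succ, rho_self, rho_low z _ (show p < p + 1 by omega), Nat.add_sub_cancel,
        rho_far z _ (show p + 1 < p + 1 + 1 by omega), map_add, map_smul, rho_sq, smul_add]
      refine congrFun ?_ c
      abel
    · rcases Nat.lt_or_ge (j + 2) p with h2 | h2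
      · simp only [rho_far z _ (show j + 1 < p by omega), rho_far z _ (show j + 1 + 1 < p by omega)]
        exact ih j _
      · rcases (show p = j + 1 ∨ p = j + 2 by omega) with rfl | rfl
        · simp only [rho_succ, rho_self, rho_far z _ (show j + 1 < j + 1 + 1 by omega),
            rho_low z _ (show j < j + 1 by omega), Nat.add_sub_cancel, map_add, map_smul]
        · have e1 : ∀ g : Space R, slice (j + 2) (rho z (j + 1) g) = slice (j + 1) g :=
            fun g => rho_succ z (j + 1) g
          simp only [e1, rho_succ, rho_far z _ (show j + 1 < j + 2 by omega),
            rho_low z _ (show j < j + 1 by omega), Nat.add_sub_cancel]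

theorem rho_braid (j : ℕ) (f : Space R) :
    rho z j (rho z (j + 1) (rho z j f)) = rho z (j + 1) (rho z j (rho z (j + 1) f)) :=
  funext fun c => rho_braid_aux z c j f

theorem ext_slice {f g : Space R} (h0 : f [] = g [])
    (h : ∀ p, slice (R := R) p f = slice (R := R) p g) : f = g := by
  funext c
  cases c with
  | nil => exact h0
  | cons p c => exact congrFun (h p) c

/-! Left multiplications -/

def pwFun (L : Space R →ₗ[R] Space R) (f : Space R) : Space R
  | [] => 0
  | p :: c => L (slice (R := R) p f) c

/-- Left multiplication by an element on one strand fewer. -/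
def pw (L : Space R →ₗ[R] Space R) : Space R →ₗ[R] Space R where
  toFun := pwFun L
  map_add' f g := by funext c; cases c <;> simp [pwFun]
  map_smul' a f := by funext c; cases c <;> simp [pwFun]

theorem pw_slice (L : Space R →ₗ[R] Space R) (p : ℕ) (f : Space R) :
    slice (R := R) p (pw L f) = L (slice (R := R) p f) := rfl

/-- Left multiplication by the last generator. -/
def topFun (f : Space R) : Space R
  | [] => 0
  | [_] => 0
  | p :: r :: c => if r < p then f (r :: (p - 1) :: c) else f ((r + 1) :: p :: c) + z • f (p :: r :: c)

def top : Space R →ₗ[R] Space R where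
  toFun := topFun z
  map_add' f g := by
    funext c
    match c with
    | [] => simp [topFun]
    | [_] => simp [topFun]
    | p :: r :: c =>
      simp only [topFun, Pi.add_apply]
      split_ifs <;> simp
      abel
  map_smul' a f := by
    funext c
    match c with
    | [] => simp [topFun]
    | [_] => simp [topFun]
    | p :: r :: c =>
      simp only [topFun, Pi.smul_apply]
      split_ifs <;> simp [smul_comm z a]

theorem top_lt {p r : ℕ} (h : r < p) (f : Space R) :
    slice (R := R) r (slice (R := R) p (top z f)) = slice (R := R) (p - 1) (slice (R := R) r f) := by
  funext c; simp [slice, top, topFun, h]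

theorem top_ge {p r : ℕ} (h : p ≤ r) (f : Space R) :
    slice (R := R) r (slice (R := R) p (top z f)) =
      slice (R := R) p (slice (R := R) (r + 1) f) + z • slice (R := R) r (slice (R := R) p f) := by
  funext c; simp [slice, top, topFun, h]

theorem rho_nil_zero {j : ℕ} {f : Space R} (h : f [] = 0) : rho z j f [] = 0 := by
  simp [rho_nil, h]

theorem rho_single_zero {j : ℕ} {f : Space R} (h : ∀ p, f [p] = 0) (p : ℕ) : rho z j f [p] = 0 := by
  suffices h0 : slice (R := R) p (rho z j f) [] = 0 from h0
  have h' : ∀ p, slice (R := R) p f [] = 0 := h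
  rcases lt_trichotomy p j with h1 | rfl | h1
  · rw [rho_low z _ h1, rho_nil_zero z (h' _)]
  · rw [rho_self]; simp [h']
  · rcases Nat.lt_or_ge (j + 1) p with h2 | h2
    · rw [rho_far z _ h2, rho_nil_zero z (h' _)]
    · obtain rfl : p = j + 1 := by omega
      rw [rho_succ, h']

theorem rho_succ' {p j : ℕ} (h : p = j + 1) (f : Space R) :
    slice p (rho z j f) = slice j f := by subst h; exact rho_succ z j f

theorem rho_self' {p j : ℕ} (h : p = j) (f : Space R) :
    slice p (rho z j f) = slice (j + 1) f + z • slice j f := by subst h; exact rho_self z p f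

theorem top_rho (j : ℕ) (f : Space R) : top z (rho z j f) = rho z j (top z f) := by
  apply ext_slice
  · rw [rho_nil_zero]; rfl; rfl
  intro p
  apply ext_slice
  · change (0 : R × R) = rho z j (top z f) [p]
    rw [rho_single_zero]; intro p; rfl
  intro r
  rcases (show p < j ∨ p = j ∨ p = j + 1 ∨ j + 1 < p by omega) with hp | hp | hp | hp <;>
  rcases (show r + 1 < j ∨ r + 1 = j ∨ r = j ∨ r = j + 1 ∨ j + 1 < r by omega) with
    hr | hr | hr | hr | hr <;>
  rcases (show r < p ∨ p ≤ r by omega) with hrp | hrp <;>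
  first
  | omega
  | (first | subst hp | skip
     first | subst hr | skip
     simp (disch := omega) only [top_lt, top_ge, rho_far, rho_low, rho_succ', rho_self', map_add,
       map_smul, Nat.add_sub_cancel, Nat.sub_add_cancel]
     try (simp only [smul_add]; abel))

/-! The conditional expectation and the trace -/

/-- Right multiplication by `g_{p+d-1} ⋯ g_{p+1} g_p`. -/
def chain (p : ℕ) : ℕ → Space R →ₗ[R] Space R
  | 0 => LinearMap.id
  | d + 1 => chain p d ∘ₗ rho z (p + d)

theorem chain_zero (p : ℕ) (x : Space R) : chain z p 0 x = x := rfl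

theorem chain_succ (p d : ℕ) (x : Space R) :
    chain z p (d + 1) x = chain z p d (rho z (p + d) x) := rfl

theorem chain_far {p j : ℕ} (h : j + 1 < p) (d : ℕ) : ∀ x : Space R,
    chain z p d (rho z j x) = rho z j (chain z p d x) := by
  induction d with
  | zero => intro x; rfl
  | succ d ih => intro x; rw [chain_succ, chain_succ, ← ih, rho_comm z (show j + 1 < p + d by omega)]

theorem chain_high {p j : ℕ} (d : ℕ) (h : p + d < j) : ∀ x : Space R,
    chain z p d (rho z j x) = rho z j (chain z p d x) := by
  induction d with
  | zero => intro x; rfl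
  | succ d ih =>
    intro x
    rw [chain_succ, chain_succ, ← ih (by omega), rho_comm z (by omega)]

theorem chain_bot (p d : ℕ) : ∀ x : Space R,
    chain z p (d + 1) x = rho z p (chain z (p + 1) d x) := by
  induction d with
  | zero => intro x; rfl
  | succ d ih =>
    intro x
    rw [chain_succ, ih, chain_succ, show p + (d + 1) = p + 1 + d by omega]

theorem chain_mid {p j : ℕ} (h1 : p ≤ j) (d : ℕ) (h : j + 1 < p + d) : ∀ x : Space R,
    chain z p d (rho z j x) = rho z (j + 1) (chain z p d x) := by
  induction d with
  | zero => omega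
  | succ d ih =>
    intro x
    rcases Nat.lt_or_ge (j + 1) (p + d) with h2 | h2
    · rw [chain_succ, chain_succ, ← ih h2, rho_comm z h2]
    · obtain ⟨e, rfl⟩ : ∃ e, d = e + 1 := ⟨d - 1, by omega⟩
      obtain rfl : j = p + e := by omega
      simp only [chain_succ]
      rw [← chain_high z e (by omega), show p + (e + 1) = p + e + 1 by omega, rho_braid]

theorem chain_shift {p q : ℕ} (h1 : p ≤ q) (d e : ℕ) (h : q + e < p + d) : ∀ x : Space R,
    chain z p d (chain z q e x) = chain z (q + 1) e (chain z p d x) := by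
  induction e with
  | zero => intro x; rfl
  | succ e ih =>
    intro x
    rw [chain_succ, chain_succ, ih (by omega), chain_mid z (by omega) d (by omega),
      show q + 1 + e = q + e + 1 by omega]

variable (vi δ : R)

/-- The conditional expectation from `n + 1` strands to `n` strands. -/
def expect (n : ℕ) : Space R →ₗ[R] Space R :=
  δ • slice n + vi • ∑ p ∈ Finset.range n, chain z p (n - 1 - p) ∘ₗ slice p

theorem expect_apply (n : ℕ) (f : Space R) : expect z vi δ n f =
    δ • slice (R := R) n f +
      vi • ∑ p ∈ Finset.range n, chain z p (n - 1 - p) (slice (R := R) p f) := by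
  simp [expect, LinearMap.sum_apply]

theorem expect_rho {n j : ℕ} (h : j + 1 < n) (f : Space R) :
    expect z vi δ n (rho z j f) = rho z j (expect z vi δ n f) := by
  have key : ∑ p ∈ Finset.range n, (chain z p (n - 1 - p) (slice (R := R) p (rho z j f)) -
      rho z j (chain z p (n - 1 - p) (slice (R := R) p f))) = 0 := by
    have hsub : ({j, j + 1} : Finset ℕ) ⊆ Finset.range n := by
      intro p hp
      simp only [Finset.mem_insert, Finset.mem_singleton] at hp
      simp only [Finset.mem_range]
      omega
    rw [← Finset.sum_subset hsub]
    · rw [Finset.sum_pair (by omega), rho_self, rho_succ,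
        show n - 1 - j = (n - 1 - (j + 1)) + 1 by omega]
      simp only [chain_bot, map_add, map_smul, rho_sq]
      abel
    · intro p hp hp'
      simp only [Finset.mem_insert, Finset.mem_singleton] at hp'
      simp only [Finset.mem_range] at hp
      rcases Nat.lt_or_ge p j with h1 | h1
      · obtain ⟨i, rfl⟩ : ∃ i, j = i + 1 := ⟨j - 1, by omega⟩
        rw [rho_low z _ h1, Nat.add_sub_cancel, chain_mid z (by omega) _ (by omega), sub_self]
      · rw [rho_far z _ (by omega), chain_far z (by omega), sub_self]
  rw [Finset.sum_sub_distrib, sub_eq_zero] at key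
  rw [expect_apply, expect_apply, key, rho_far z _ h, map_add, map_smul, map_smul, map_sum]

theorem expect_chain {n p d : ℕ} (h : p + d < n) : ∀ x : Space R,
    expect z vi δ n (chain z p d x) = chain z p d (expect z vi δ n x) := by
  induction d with
  | zero => intro x; rfl
  | succ d ih => intro x; rw [chain_succ, chain_succ, ih (by omega), expect_rho _ _ _ (by omega)]

theorem chain_comm_of {L : Space R →ₗ[R] Space R} (hL : ∀ j x, L (rho z j x) = rho z j (L x))
    (p d : ℕ) : ∀ x : Space R, chain z p d (L x) = L (chain z p d x) := by
  induction d with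
  | zero => intro x; rfl
  | succ d ih => intro x; rw [chain_succ, chain_succ, ← hL, ih]

theorem expect_pw {L : Space R →ₗ[R] Space R} (hL : ∀ j x, L (rho z j x) = rho z j (L x))
    (n : ℕ) (f : Space R) : expect z vi δ n (pw L f) = L (expect z vi δ n f) := by
  simp only [expect_apply, pw_slice, chain_comm_of z hL, map_add, map_smul, map_sum]

def insFun (p : ℕ) (x : Space R) : Space R
  | [] => 0
  | q :: c => if q = p then x c else 0

/-- The element whose only component is `x`, at position `p` of the last strand. -/
def ins (p : ℕ) : Space R →ₗ[R] Space R where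
  toFun := insFun p
  map_add' f g := by
    funext c; cases c <;> simp [insFun]
    split_ifs <;> simp
  map_smul' a f := by funext c; cases c <;> simp [insFun]

theorem ins_nil (p : ℕ) (x : Space R) : (ins p : Space R →ₗ[R] Space R) x [] = 0 := rfl

theorem slice_ins (p q : ℕ) (x : Space R) :
    slice (R := R) q (ins (R := R) p x) = if q = p then x else 0 := by
  funext c
  by_cases h : q = p <;> simp [slice, ins, insFun, h]

theorem expect_ins_eq (n : ℕ) (x : Space R) : expect z vi δ n (ins (R := R) n x) = δ • x := by
  rw [expect_apply, slice_ins, if_pos rfl, Finset.sum_eq_zero, smul_zero, add_zero]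
  intro p hp
  rw [slice_ins, if_neg (by simp at hp; omega), map_zero]

theorem expect_ins_lt {n p : ℕ} (h : p < n) (x : Space R) :
    expect z vi δ n (ins (R := R) p x) = vi • chain z p (n - 1 - p) x := by
  rw [expect_apply, slice_ins, if_neg (by omega), smul_zero, zero_add,
    Finset.sum_eq_single p]
  · rw [slice_ins, if_pos rfl]
  · intro q _ hq
    rw [slice_ins, if_neg hq, map_zero]
  · intro hp; simp at hp; omega

theorem rho_ins_far {j p : ℕ} (h : j + 1 < p) (x : Space R) :
    rho z j (ins (R := R) p x) = ins (R := R) p (rho z j x) := by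
  apply ext_slice (by rw [rho_nil_zero]; rfl; rfl)
  intro q
  rw [slice_ins]
  rcases (show q < j ∨ q = j ∨ q = j + 1 ∨ j + 1 < q by omega) with hp | hp | hp | hp
  · rw [rho_low z _ hp, slice_ins, if_neg (by omega), if_neg (by omega), map_zero]
  · rw [rho_self' z hp, slice_ins, slice_ins, if_neg (by omega), if_neg (by omega),
      if_neg (by omega)]; simp
  · rw [rho_succ' z hp, slice_ins, if_neg (by omega), if_neg (by omega)]
  · rw [rho_far z _ hp, slice_ins]; split_ifs <;> simp

theorem rho_ins_low {j p : ℕ} (h : p < j) (x : Space R) :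
    rho z j (ins (R := R) p x) = ins (R := R) p (rho z (j - 1) x) := by
  apply ext_slice (by rw [rho_nil_zero]; rfl; rfl)
  intro q
  rw [slice_ins]
  rcases (show q < j ∨ q = j ∨ q = j + 1 ∨ j + 1 < q by omega) with hp | hp | hp | hp
  · rw [rho_low z _ hp, slice_ins]; split_ifs <;> simp
  · rw [rho_self' z hp, slice_ins, slice_ins, if_neg (by omega), if_neg (by omega),
      if_neg (by omega)]; simp
  · rw [rho_succ' z hp, slice_ins, if_neg (by omega), if_neg (by omega)]
  · rw [rho_far z _ hp, slice_ins, if_neg (by omega), if_neg (by omega), map_zero]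

theorem rho_ins_succ (j : ℕ) (x : Space R) :
    rho z j (ins (R := R) (j + 1) x) = ins (R := R) j x := by
  apply ext_slice (by rw [rho_nil_zero]; rfl; rfl)
  intro q
  rw [slice_ins]
  rcases (show q < j ∨ q = j ∨ q = j + 1 ∨ j + 1 < q by omega) with hp | hp | hp | hp
  · rw [rho_low z _ hp, slice_ins, if_neg (by omega), if_neg (by omega), map_zero]
  · rw [rho_self' z hp, slice_ins, slice_ins, if_pos (by omega), if_neg (by omega),
      if_pos (by omega)]; simp
  · rw [rho_succ' z hp, slice_ins, if_neg (by omega), if_neg (by omega)]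
  · rw [rho_far z _ hp, slice_ins, if_neg (by omega), if_neg (by omega), map_zero]

theorem rho_ins_self (j : ℕ) (x : Space R) :
    rho z j (ins (R := R) j x) = ins (R := R) (j + 1) x + z • ins (R := R) j x := by
  rw [← rho_ins_succ z j x, rho_sq, rho_ins_succ, add_comm]

theorem slice_slice_ins (p r q s : ℕ) (a : Space R) :
    slice (R := R) s (slice (R := R) q (ins (R := R) p (ins (R := R) r a))) =
      if q = p ∧ s = r then a else 0 := by
  rw [slice_ins]
  by_cases h : q = p
  · simp [h, slice_ins]
  · simp [h]

theorem top_ins_lt {p r : ℕ} (h : r < p) (a : Space R) :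
    top z (ins (R := R) p (ins (R := R) r a)) = ins (R := R) r (ins (R := R) (p - 1) a) := by
  refine ext_slice (R := R) rfl fun q => ?_
  refine ext_slice (R := R) ?_ fun s => ?_
  · rw [slice_ins]; split_ifs <;> rfl
  rcases Nat.lt_or_ge s q with hs | hs
  · rw [top_lt z hs, slice_slice_ins, slice_slice_ins, if_neg (by omega), if_neg (by omega)]
  · rw [top_ge z hs, slice_slice_ins, slice_slice_ins, slice_slice_ins,
      if_neg (show ¬ (q = p ∧ s = r) by omega), smul_zero, add_zero]
    exact if_congr (by omega) rfl rfl

theorem top_ins_ge {p r : ℕ} (h : p ≤ r) (a : Space R) :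
    top z (ins (R := R) p (ins (R := R) r a)) =
      ins (R := R) (r + 1) (ins (R := R) p a) + z • ins (R := R) p (ins (R := R) r a) := by
  refine ext_slice (R := R) (by simp [ins_nil]; rfl) fun q => ?_
  refine ext_slice (R := R) ?_ fun s => ?_
  · rw [map_add, map_smul, slice_ins, slice_ins]
    split_ifs <;> simp [ins_nil] <;> rfl
  rw [map_add, map_smul, map_add, map_smul]
  rcases Nat.lt_or_ge s q with hs | hs
  · rw [top_lt z hs, slice_slice_ins, slice_slice_ins, slice_slice_ins,
      if_neg (show ¬ (q = p ∧ s = r) by omega), smul_zero, add_zero]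
    exact if_congr (by omega) rfl rfl
  · rw [top_ge z hs, slice_slice_ins, slice_slice_ins, slice_slice_ins,
      if_neg (show ¬ (s + 1 = p ∧ q = r) by omega),
      if_neg (show ¬ (q = r + 1 ∧ s = p) by omega)]

def Low (n : ℕ) (x : Space R) : Prop := ∀ r, r ≤ n → slice (R := R) r x = 0

theorem Low.rho {n j : ℕ} {x : Space R} (h : Low n x) (hj : j < n) : Low n (rho z j x) := by
  intro q hq
  rcases (show q < j ∨ q = j ∨ q = j + 1 ∨ j + 1 < q by omega) with hp | hp | hp | hp
  · rw [rho_low z _ hp, h _ (by omega), map_zero]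
  · rw [rho_self' z hp, h _ (by omega), h _ (by omega)]; simp
  · rw [rho_succ' z hp, h _ (by omega)]
  · rw [rho_far z _ hp, h _ (by omega), map_zero]

theorem Low.chain {n p d : ℕ} (hj : p + d ≤ n) : ∀ {x : Space R}, Low n x →
    Low n (chain z p d x) := by
  induction d with
  | zero => intro x h; exact h
  | succ d ih => intro x h; exact ih (by omega) (h.rho z (by omega))

theorem Low.expect_eq {n : ℕ} {x : Space R} (h : Low n x) : expect z vi δ n x = 0 := by
  rw [expect_apply, h n le_rfl, smul_zero, zero_add, Finset.sum_eq_zero, smul_zero]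
  intro p hp
  rw [h p (by simp at hp; omega), map_zero]

theorem expect_low {n : ℕ} {x : Space R} (h : ∀ p, p ≤ n + 1 → Low n (slice (R := R) p x)) :
    expect z vi δ n (expect z vi δ (n + 1) x) = 0 := by
  rw [expect_apply z vi δ (n + 1), map_add, map_smul, map_smul, map_sum,
    (h (n + 1) le_rfl).expect_eq, Finset.sum_eq_zero]
  · simp
  · intro p hp
    simp only [Finset.mem_range] at hp
    exact ((h p (by omega)).chain z (by omega)).expect_eq z vi δ

theorem expect_top_ins {n p r : ℕ} (hn : 1 ≤ n) (hp : p ≤ n + 1) (hr : r ≤ n) (a : Space R) :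
    expect z vi δ n (expect z vi δ (n + 1) (top z (ins (R := R) p (ins (R := R) r a)))) =
    expect z vi δ n (expect z vi δ (n + 1) (rho z n (ins (R := R) p (ins (R := R) r a)))) := by
  obtain ⟨m, rfl⟩ : ∃ m, n = m + 1 := ⟨n - 1, by omega⟩
  -- the chain of length one more, applied to an inserted element
  have hE : ∀ q, q < m + 1 → ∀ y : Space R,
      expect z vi δ (m + 1) (expect z vi δ (m + 1 + 1) (ins (R := R) q y)) =
        vi • chain z q (m - q) (expect z vi δ (m + 1) (rho z m y)) := by
    intro q hq y
    rw [expect_ins_lt _ _ _ (by omega), map_smul,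
      show m + 1 + 1 - 1 - q = (m - q) + 1 by omega, chain_succ, show q + (m - q) = m by omega,
      expect_chain _ _ _ (by omega)]
  have hE' : ∀ y : Space R,
      expect z vi δ (m + 1) (expect z vi δ (m + 1 + 1) (ins (R := R) (m + 1) y)) =
        vi • expect z vi δ (m + 1) y := by
    intro y
    rw [expect_ins_lt _ _ _ (by omega), map_smul, show m + 1 + 1 - 1 - (m + 1) = 0 by omega,
      chain_zero]
  have hE'' : ∀ y : Space R,
      expect z vi δ (m + 1) (expect z vi δ (m + 1 + 1) (ins (R := R) (m + 1 + 1) y)) =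
        δ • expect z vi δ (m + 1) y := by
    intro y
    rw [expect_ins_eq, map_smul]
  have hF : ∀ q, q < m + 1 → ∀ y : Space R,
      expect z vi δ (m + 1) (ins (R := R) q y) = vi • chain z q (m - q) y := by
    intro q hq y
    rw [expect_ins_lt _ _ _ hq, Nat.add_sub_cancel]
  have hF' : ∀ y : Space R, expect z vi δ (m + 1) (ins (R := R) (m + 1) y) = δ • y :=
    expect_ins_eq z vi δ (m + 1)
  rcases (show p = m + 2 ∨ p = m + 1 ∨ p < m + 1 by omega) with rfl | rfl | hp'
  · rw [top_ins_lt z (by omega), rho_ins_succ, hE', show m + 2 - 1 = m + 1 by omega]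
    rcases (show r = m + 1 ∨ r < m + 1 by omega) with rfl | hr'
    · rw [hE']
    · rw [hE _ hr', rho_ins_succ, hF _ hr', hF _ (by omega), Nat.sub_self, chain_zero, map_smul]
  · rcases (show r = m + 1 ∨ r < m + 1 by omega) with rfl | hr'
    · rw [top_ins_ge z le_rfl, rho_ins_self]
    · rw [top_ins_lt z hr', rho_ins_self, Nat.add_sub_cancel, hE _ hr', rho_ins_self]
      simp only [map_add, map_smul, hE', hE'', hF', hF _ hr', hF m (by omega), Nat.sub_self,
        chain_zero, smul_add, smul_smul]
      congr 2 <;> ring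
  · rw [rho_ins_low z hp', Nat.add_sub_cancel, hE _ hp', rho_sq, map_add, map_smul]
    rcases Nat.lt_or_ge r p with hrp | hrp
    · have hz := chain_shift z (show r ≤ p - 1 by omega) (m - r) (m - p) (by omega)
      rw [top_ins_lt z hrp, hE _ (by omega), rho_ins_low z (show p - 1 < m by omega),
        rho_ins_low z (show r < m by omega), hF _ (by omega), hF _ (by omega), hF _ (by omega),
        show m - (p - 1) = (m - p) + 1 by omega, chain_succ, show p - 1 + (m - p) = m - 1 by omega,
        rho_sq]
      simp only [map_add, map_smul, hz, Nat.sub_add_cancel (show 1 ≤ p by omega), smul_add]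
      simp only [smul_comm z vi]
    · rw [top_ins_ge z hrp, map_add, map_add, map_smul, map_smul, hE _ hp', map_add, map_smul,
        smul_add, smul_comm z vi, add_comm]
      congr 1
      rcases (show r = m + 1 ∨ r = m ∨ r < m by omega) with rfl | rfl | hr'
      · rw [hE'', hF _ hp', hF', map_smul, smul_comm]
      · rw [hE', hF _ hp', hF _ (by omega), map_smul, Nat.sub_self, chain_zero]
      · rw [hE _ (by omega), rho_ins_low z (by omega), hF _ hp', hF _ (by omega), map_smul,
          map_smul, show m - r = (m - (r + 1)) + 1 by omega, chain_succ,
          show r + (m - (r + 1)) = m - 1 by omega,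
          chain_shift z hrp (m - p) (m - (r + 1)) (by omega)]

theorem expect_top {n : ℕ} (hn : 1 ≤ n) (f : Space R) :
    expect z vi δ n (expect z vi δ (n + 1) (top z f)) =
    expect z vi δ n (expect z vi δ (n + 1) (rho z n f)) := by
  set g : Space R := ∑ p ∈ Finset.range (n + 2), ∑ r ∈ Finset.range (n + 1),
    ins (R := R) p (ins (R := R) r (slice (R := R) r (slice (R := R) p f))) with hg
  have hlow : ∀ p, p ≤ n + 1 → Low n (slice (R := R) p (f - g)) := by
    intro p hp r hr
    rw [map_sub, map_sub, hg, sub_eq_zero]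
    simp only [map_sum, slice_slice_ins]
    rw [Finset.sum_eq_single p, Finset.sum_eq_single r]
    · simp
    · intro s _ hs; rw [if_neg (by omega)]
    · intro h; simp at h; omega
    · intro q _ hq
      exact Finset.sum_eq_zero fun s _ => if_neg (by omega)
    · intro h; simp at h; omega
  have h1 : expect z vi δ n (expect z vi δ (n + 1) (top z (f - g))) = 0 := by
    apply expect_low
    intro p hp r hr
    rcases Nat.lt_or_ge r p with h | h
    · rw [top_lt z h, hlow r (by omega) (p - 1) (by omega)]
    · rw [top_ge z h, hlow p hp r hr, smul_zero, add_zero]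
      exact hlow (r + 1) (by omega) p (by omega)
  have h2 : expect z vi δ n (expect z vi δ (n + 1) (rho z n (f - g))) = 0 := by
    apply expect_low
    intro p hp
    rcases (show p < n ∨ p = n ∨ p = n + 1 by omega) with h | h | h
    · rw [rho_low z _ h]; exact (hlow p hp).rho z (by omega)
    · rw [rho_self' z h]
      intro r hr
      rw [map_add, map_smul, hlow _ (by omega) r hr, hlow _ (by omega) r hr]; simp
    · rw [rho_succ' z h]; exact hlow n (by omega)
  have h3 : expect z vi δ n (expect z vi δ (n + 1) (top z g)) =
      expect z vi δ n (expect z vi δ (n + 1) (rho z n g)) := by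
    simp only [hg, map_sum]
    refine Finset.sum_congr rfl fun p hp => Finset.sum_congr rfl fun r hr => ?_
    simp only [Finset.mem_range] at hp hr
    exact expect_top_ins z vi δ hn (by omega) (by omega) _
  rw [← sub_add_cancel f g]
  simp only [map_add, h1, h2, h3]

/-- The trace on `n` strands. -/
def tr : ℕ → Space R →ₗ[R] R
  | 0 => LinearMap.fst R R R ∘ₗ LinearMap.proj []
  | 1 => LinearMap.fst R R R ∘ₗ LinearMap.proj [0]
  | n + 2 => tr (n + 1) ∘ₗ expect z vi δ (n + 1)

theorem tr_step (n : ℕ) (f : Space R) :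
    tr z vi δ (n + 2) f = tr z vi δ (n + 1) (expect z vi δ (n + 1) f) := rfl

/-- Left multiplication by `g_j` on `n` strands. -/
def lam : ℕ → ℕ → Space R →ₗ[R] Space R
  | 0, _ => 0
  | 1, _ => 0
  | n + 2, j => if j = n then top z else pw (lam (n + 1) j)

theorem pw_rho {L : Space R →ₗ[R] Space R} (hL : ∀ j x, L (rho z j x) = rho z j (L x))
    (j : ℕ) (x : Space R) : pw L (rho z j x) = rho z j (pw L x) := by
  refine ext_slice (R := R) (by rw [rho_nil_zero]; rfl; rfl) fun q => ?_
  rw [pw_slice]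
  rcases (show q < j ∨ q = j ∨ q = j + 1 ∨ j + 1 < q by omega) with hp | hp | hp | hp
  · rw [rho_low z _ hp, rho_low z _ hp, pw_slice, hL]
  · rw [rho_self' z hp, rho_self' z hp, pw_slice, pw_slice, map_add, map_smul]
  · rw [rho_succ' z hp, rho_succ' z hp, pw_slice]
  · rw [rho_far z _ hp, rho_far z _ hp, pw_slice, hL]

theorem lam_rho : ∀ (n i j : ℕ) (x : Space R), lam z n i (rho z j x) = rho z j (lam z n i x)
  | 0, _, _, _ => by simp [lam]
  | 1, _, _, _ => by simp [lam]
  | n + 2, i, j, x => by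
    unfold lam
    split_ifs
    · exact top_rho z j x
    · exact pw_rho z (fun j x => lam_rho (n + 1) i j x) j x

theorem tr_lam : ∀ (n j : ℕ) (_ : j + 1 < n) (x : Space R),
    tr z vi δ n (lam z n j x) = tr z vi δ n (rho z j x)
  | 0, _, h, _ => by omega
  | 1, _, h, _ => by omega
  | n + 2, j, h, x => by
    unfold lam
    split_ifs with hj
    · subst hj
      rw [tr_step, tr_step]
      rcases j with _ | k
      · simp only [tr, expect_apply]
        have e1 : slice (R := R) 0 (slice (R := R) 1 (top z x)) =
            slice (R := R) 0 (slice (R := R) 1 (rho z 0 x)) := by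
          rw [top_lt z (by omega), rho_succ' z rfl]
        have e2 : slice (R := R) 0 (slice (R := R) 0 (top z x)) =
            slice (R := R) 0 (slice (R := R) 0 (rho z 0 x)) := by
          rw [top_ge z le_rfl, rho_self' z rfl, map_add, map_smul]
        have e1' := congrFun e1 []
        have e2' := congrFun e2 []
        simp only [slice, LinearMap.coe_mk, AddHom.coe_mk] at e1' e2'
        simp [slice, chain, e1', e2']
      · rw [tr_step, tr_step, expect_top z vi δ (by omega)]
    · rw [tr_step, tr_step, expect_pw z vi δ (lam_rho z (n + 1) j), tr_lam (n + 1) j (by omega),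
        expect_rho _ _ _ (by omega)]

/-- The unit element on `n` strands. -/
def unit : ℕ → Space R
  | 0 => fun c => if c = [] then (1, 0) else 0
  | n + 1 => ins (R := R) n (unit n)

theorem lam_unit : ∀ (n j : ℕ) (_ : j + 1 < n),
    lam z n j (unit n : Space R) = rho z j (unit n)
  | 0, _, h => by omega
  | 1, _, h => by omega
  | n + 2, j, h => by
    unfold lam
    split_ifs with hj
    · subst hj
      simp only [unit]
      rw [top_ins_lt z (by omega), rho_ins_succ, Nat.add_sub_cancel]
    · have ih := lam_unit (n + 1) j (by omega)
      have e : (unit (n + 2) : Space R) = ins (R := R) (n + 1) (unit (n + 1)) := rfl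
      rw [e, rho_ins_far z (by omega), ← ih]
      refine ext_slice (R := R) rfl fun q => ?_
      rw [pw_slice, slice_ins, slice_ins]
      split_ifs <;> simp


variable (v : R)

/-- The action of `σ_j`. -/
def act (hv : v * vi = 1) (j : ℕ) : (Module.End R (Space R))ˣ where
  val := v • rho z j
  inv := vi • (rho z j - z • LinearMap.id)
  val_inv := by
    ext1 x
    simp only [Module.End.mul_apply, LinearMap.smul_apply, LinearMap.sub_apply, map_smul, map_sub,
      LinearMap.id_apply, rho_sq]
    rw [smul_comm z v, ← smul_sub, smul_smul, mul_comm vi v, hv, one_smul]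
    simp
  inv_val := by
    ext1 x
    simp only [Module.End.mul_apply, LinearMap.smul_apply, LinearMap.sub_apply, map_smul,
      LinearMap.id_apply, rho_sq]
    rw [smul_smul, hv, one_smul]
    simp

theorem act_apply (hv : v * vi = 1) (j : ℕ) (x : Space R) :
    (act z vi v hv j : Module.End R (Space R)) x = v • rho z j x := rfl

theorem act_inv_apply (hv : v * vi = 1) (j : ℕ) (x : Space R) :
    ((act z vi v hv j)⁻¹ : (Module.End R (Space R))ˣ).val x = vi • (rho z j x - z • x) := rfl

/-- The action of the braid group on `n` strands. -/
def rep (hv : v * vi = 1) (n : ℕ) : BraidGroup n →* (Module.End R (Space R))ˣ :=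
  PresentedGroup.toGroup (f := fun i : Fin (n - 1) => act z vi v hv i) (by
    rintro r (⟨i, j, h, rfl⟩ | ⟨i, j, h, rfl⟩)
    · simp only [map_mul, map_inv, FreeGroup.lift_apply_of]
      refine mul_inv_eq_one.mpr (Units.ext (LinearMap.ext fun x => ?_))
      simp only [Units.val_mul, Module.End.mul_apply, act_apply, map_smul, ← h, rho_braid]
    · simp only [map_mul, map_inv, FreeGroup.lift_apply_of]
      refine mul_inv_eq_one.mpr (Units.ext (LinearMap.ext fun x => ?_))
      simp only [Units.val_mul, Module.End.mul_apply, act_apply, map_smul, rho_comm z h])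

theorem rep_σ (hv : v * vi = 1) {n : ℕ} (i : Fin (n - 1)) :
    rep z vi v hv n (BraidGroup.σ i) = act z vi v hv i :=
  PresentedGroup.toGroup.of _

/-- The value on the closure of a braid. -/
def value (hv : v * vi = 1) {n : ℕ} (β : BraidGroup n) : R :=
  tr z vi δ n ((rep z vi v hv n β : Module.End R (Space R)) (unit n))

theorem lam_rep (hv : v * vi = 1) {n : ℕ} (i : ℕ) (β : BraidGroup n) : ∀ x : Space R,
    lam z n i ((rep z vi v hv n β : Module.End R (Space R)) x) =
      (rep z vi v hv n β : Module.End R (Space R)) (lam z n i x) := by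
  induction β using BraidGroup.induction_generators with
  | hσ j => intro x; rw [rep_σ, act_apply, act_apply, map_smul, lam_rho]
  | h1 => intro x; simp
  | hmul α β hα hβ =>
    intro x
    simp only [map_mul, Units.val_mul, Module.End.mul_apply, hα, hβ]
  | hinv α hα =>
    intro x
    set u := rep z vi v hv n α with hu
    have e : ∀ y : Space R, (u⁻¹).val (u.val y) = y := fun y => by
      rw [← Module.End.mul_apply, Units.inv_mul, Module.End.one_apply]
    have e' : ∀ y : Space R, u.val ((u⁻¹).val y) = y := fun y => by
      rw [← Module.End.mul_apply, Units.mul_inv, Module.End.one_apply]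
    rw [map_inv, ← hu, ← e (lam z n i _), ← hα, e']

theorem value_conj (hv : v * vi = 1) {n : ℕ} (α : BraidGroup n) : ∀ β : BraidGroup n,
    value z vi δ v hv (α * β) = value z vi δ v hv (β * α) := by
  induction α using BraidGroup.induction_generators with
  | hσ j =>
    intro β
    have hj : (j : ℕ) + 1 < n := by omega
    simp only [value, map_mul, Units.val_mul, Module.End.mul_apply, rep_σ, act_apply, map_smul]
    rw [← tr_lam z vi δ n j hj, lam_rep, lam_unit z n j hj]
  | h1 => intro β; simp
  | hmul α β hα hβ =>
    intro γ
    rw [mul_assoc, hα, mul_assoc, hβ, mul_assoc]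
  | hinv α hα =>
    intro β
    have h := hα (α⁻¹ * β * α⁻¹)
    simpa [mul_assoc] using h.symm

theorem expect_rep (hv : v * vi = 1) {n : ℕ} (β : BraidGroup n) : ∀ x : Space R,
    expect z vi δ n ((rep z vi v hv (n + 1) (BraidGroup.addStrand n β)).val x) =
      (rep z vi v hv n β).val (expect z vi δ n x) := by
  induction β using BraidGroup.induction_generators with
  | hσ j =>
    intro x
    have hj : (j : ℕ) + 1 < n := by omega
    rw [BraidGroup.addStrand_σ, rep_σ, rep_σ, act_apply, act_apply, map_smul, expect_rho _ _ _ hj]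
  | h1 => intro x; simp
  | hmul α β hα hβ =>
    intro x
    simp only [map_mul, Units.val_mul, Module.End.mul_apply, hα, hβ]
  | hinv α hα =>
    intro x
    set u := rep z vi v hv n α with hu
    set w := rep z vi v hv (n + 1) (BraidGroup.addStrand n α) with hw
    have e : ∀ y : Space R, (u⁻¹).val (u.val y) = y := fun y => by
      rw [← Module.End.mul_apply, Units.inv_mul, Module.End.one_apply]
    have e' : ∀ y : Space R, w.val ((w⁻¹).val y) = y := fun y => by
      rw [← Module.End.mul_apply, Units.mul_inv, Module.End.one_apply]
    rw [map_inv, map_inv, map_inv, ← hu, ← hw, ← e (expect z vi δ n _), ← hα, e']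

theorem expect_ins_pred (k : ℕ) (x : Space R) :
    expect z vi δ (k + 1) (ins (R := R) k x) = vi • x := by
  rw [expect_ins_lt _ _ _ (by omega), Nat.add_sub_cancel, Nat.sub_self, chain_zero]

theorem value_stabPos (hv : v * vi = 1) {n : ℕ} (hn : 0 < n) (α : BraidGroup n) :
    value z vi δ v hv (BraidGroup.addStrand n α * BraidGroup.σ ⟨n - 1, by omega⟩) =
      value z vi δ v hv α := by
  obtain ⟨k, rfl⟩ : ∃ k, n = k + 1 := ⟨n - 1, by omega⟩
  simp only [value, map_mul, Units.val_mul, Module.End.mul_apply, rep_σ, act_apply, unit]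
  rw [tr_step, expect_rep, show rho z (k + 1 - 1) = rho z k from rfl, rho_ins_succ, map_smul,
    expect_ins_pred, smul_smul, hv, one_smul]

theorem value_stabNeg (hv : v * vi = 1) (hδ : z * δ = vi - v) {n : ℕ} (hn : 0 < n)
    (α : BraidGroup n) :
    value z vi δ v hv (BraidGroup.addStrand n α * (BraidGroup.σ ⟨n - 1, by omega⟩)⁻¹) =
      value z vi δ v hv α := by
  obtain ⟨k, rfl⟩ : ∃ k, n = k + 1 := ⟨n - 1, by omega⟩
  simp only [value, map_mul, map_inv, Units.val_mul, Module.End.mul_apply, rep_σ, act_inv_apply,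
    unit]
  rw [tr_step, expect_rep, show rho z (k + 1 - 1) = rho z k from rfl, rho_ins_succ,
    map_smul (expect z vi δ (k + 1)), map_sub (expect z vi δ (k + 1)),
    map_smul (expect z vi δ (k + 1)), expect_ins_pred, expect_ins_eq, smul_smul z, hδ,
    ← sub_smul, smul_smul, sub_sub_cancel, mul_comm, hv, one_smul]

theorem value_skein (hv : v * vi = 1) {n : ℕ} (α β : BraidGroup n) (i : Fin (n - 1)) :
    vi * value z vi δ v hv (α * BraidGroup.σ i * β) -
      v * value z vi δ v hv (α * (BraidGroup.σ i)⁻¹ * β) = z * value z vi δ v hv (α * β) := by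
  simp only [value, map_mul, map_inv, Units.val_mul, Module.End.mul_apply, rep_σ, act_apply,
    act_inv_apply, map_smul, map_sub, smul_eq_mul]
  linear_combination (z * tr z vi δ n ((rep z vi v hv n α).val
    ((rep z vi v hv n β).val (unit n)))) * hv

theorem value_one (hv : v * vi = 1) : value z vi δ v hv (1 : BraidGroup 1) = 1 := by
  simp [value, tr, unit, ins, insFun]

end HomflyTrace

theorem exists_isHomfly : ∃ P : OrientedLink → LaurentVZ, IsHomfly P := by
  have hv : LaurentVZ.v 1 * LaurentVZ.v (-1) = 1 := by
    rw [LaurentVZ.v, LaurentVZ.v, ← LaurentPolynomial.T_add]; simp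
  have hz : LaurentVZ.z 1 * LaurentVZ.z (-1) = 1 := by
    rw [LaurentVZ.z, LaurentVZ.z, ← map_mul, ← LaurentPolynomial.T_add]; simp
  have hδ : LaurentVZ.z 1 * (LaurentVZ.z (-1) * (LaurentVZ.v (-1) - LaurentVZ.v 1)) =
      LaurentVZ.v (-1) - LaurentVZ.v 1 := by
    rw [← mul_assoc, hz, one_mul]
  refine ⟨Quot.lift (fun b => HomflyTrace.value (LaurentVZ.z 1) (LaurentVZ.v (-1))
    (LaurentVZ.z (-1) * (LaurentVZ.v (-1) - LaurentVZ.v 1)) (LaurentVZ.v 1) hv b.braid) ?_,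
    ?_, ?_⟩
  · rintro _ _ (⟨hn, α, β⟩ | ⟨hn, α⟩ | ⟨hn, α⟩)
    · exact HomflyTrace.value_conj _ _ _ _ hv α β
    · exact HomflyTrace.value_stabPos _ _ _ _ hv hn α
    · exact HomflyTrace.value_stabNeg _ _ _ _ hv hδ hn α
  · exact HomflyTrace.value_one _ _ _ _ hv
  · intro n hn α β i
    exact HomflyTrace.value_skein _ _ _ _ hv α β i

/-- The Homfly polynomial of an oriented link. The skein relation and the value on the unknot
determine it uniquely. -/
noncomputable def homfly : OrientedLink → LaurentVZ := Classical.choose exists_isHomfly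

theorem homfly_isHomfly : IsHomfly homfly := Classical.choose_spec exists_isHomfly

/-! ### Sequences of group elements satisfying Artin's relations -/

/-! Let `framedColumn n e` be the coefficient of `v ^ (w + e)` in the Homfly polynomial of a closed
braid of writhe `w` on `n + 1` strands. The shift by `w` absorbs the powers of `v` in the skein
relation, so it is a conjugation invariant function `f` with `f (α σ β) - f (α σ⁻¹ β) = z f (α β)`.
Stabilization by `σ` or `σ⁻¹` lowers the number of strands and moves `e` to `e + 1` or `e - 1`.

Such functions are computed by reducing positive words. With braid relations a positive word
acquires a square of a generator, which resolves into shorter positive words, or its last generator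
occurs at most once; then conjugation and (de)stabilization remove a strand. Hence a conjugation
invariant skein function vanishes as soon as it does on braids `α` and `α σ_last`, with `α` on one
strand fewer (`IsSkein.eq_zero_of_addStrand`). A first application gives the Morton–Franks–Williams
bounds: `framedColumn n e = 0` for `|e| > n`.

The theorem compares the extreme values `e = -n` and `e = n`. Since `Δ²` is central, `β ↦
framedColumn n (-n) β - (-1) ^ n framedColumn n n (β Δ²)` is again a conjugation invariant skein
function, and its vanishing is proved by induction on `n`. The top column vanishes on braids with a
single positive last generator. The full twist is the full twist on one strand fewer times a full
turn of the last strand; resolving the squares in that turn leaves such braids as error terms, so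
the top column does not see the turn. The sign arises because deleting a free strand multiplies the
top column by `-z` but the bottom one by `z`.

It remains to see that these are the actual outermost columns, i.e. that they are non-zero. For
positive braids the reduction computes the bottom column without cancellation, so its value at `z =
1` is positive; the top column of `β Δ²` is then non-zero by the identity. -/

/-- A sequence in a group whose distant members commute, and whose first `N` members satisfy the
braid relations. -/
structure BraidSequence {G : Type*} [Group G] (s : ℕ → G) (N : ℕ) : Prop where
  comm : ∀ i j, i + 1 < j → s i * s j = s j * s i
  braid : ∀ i, i + 1 < N → s i * s (i + 1) * s i = s (i + 1) * s i * s (i + 1)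

namespace BraidSequence

variable {G : Type*} [Group G] {s : ℕ → G} {N : ℕ}

/-! ### Positive words and their squares -/

/-- The value of a positive word. -/
def word (s : ℕ → G) (w : List ℕ) : G := (w.map s).prod

@[simp] theorem word_nil (s : ℕ → G) : word s [] = 1 := rfl

@[simp] theorem word_cons (s : ℕ → G) (a : ℕ) (w : List ℕ) : word s (a :: w) = s a * word s w := by
  simp [word]

@[simp] theorem word_append (s : ℕ → G) (u w : List ℕ) :
    word s (u ++ w) = word s u * word s w := by
  simp [word]

/-- The word `w` equals a word of the same length in the first `m` members which contains the
square of one of them. -/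
def HasSquare (s : ℕ → G) (m : ℕ) (w : List ℕ) : Prop :=
  ∃ (u : List ℕ) (i : ℕ) (v : List ℕ), i < m ∧ (∀ j ∈ u, j < m) ∧ (∀ j ∈ v, j < m) ∧
    u.length + v.length + 2 = w.length ∧ word s w = word s u * (s i * s i) * word s v

theorem comm_word (h : BraidSequence s N) {m : ℕ} {w : List ℕ} (hw : ∀ i ∈ w, i + 1 < m) :
    s m * word s w = word s w * s m := by
  induction w with
  | nil => simp
  | cons a w ih =>
    rw [word_cons, ← mul_assoc, ← h.comm a m (hw a (by simp)), mul_assoc,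
      ih fun i hi => hw i (by simp [hi]), mul_assoc]

/-- A positive word in the first `m + 1` members equals one that contains a square, or one in which
the last of them occurs at most once. -/
theorem hasSquare_or_reduced (h : BraidSequence s N) : ∀ (m : ℕ) (_ : m < N) (w : List ℕ)
    (_ : ∀ i ∈ w, i < m + 1), HasSquare s (m + 1) w ∨ (∀ i ∈ w, i < m) ∨
      ∃ u v : List ℕ, (∀ i ∈ u, i < m) ∧ (∀ i ∈ v, i < m) ∧
        u.length + v.length + 1 = w.length ∧ word s w = word s u * s m * word s v
  | m, hm, [], _ => Or.inr (Or.inl (by simp))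
  | m, hm, a :: w, hw => by
    have ha : a < m + 1 := hw a (by simp)
    have hw' : ∀ i ∈ w, i < m + 1 := fun i hi => hw i (by simp [hi])
    rcases hasSquare_or_reduced h m hm w hw' with
      ⟨u, i, v, hi, hu, hv, hl, he⟩ | hp | ⟨u, v, hu, hv, hl, he⟩
    · refine Or.inl ⟨a :: u, i, v, hi, List.forall_mem_cons.2 ⟨ha, hu⟩, hv, ?_, ?_⟩
      · simp only [List.length_cons]; omega
      · simp only [word_cons, he, mul_assoc]
    · rcases (show a < m ∨ a = m by omega) with ha' | rfl
      · exact Or.inr (Or.inl (by simpa using ⟨ha', hp⟩))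
      · exact Or.inr (Or.inr ⟨[], w, by simp, hp, by simp, by simp⟩)
    -- Now `s m` occurs exactly once in the tail. The critical case is `a = m`, where the word has
    -- the form `s m · u · s m · v`.
    rcases (show a < m ∨ a = m by omega) with ha' | rfl
    · refine Or.inr (Or.inr ⟨a :: u, v, by simpa using ⟨ha', hu⟩, hv, ?_, ?_⟩)
      · simp only [List.length_cons]; omega
      · simp only [word_cons, he, mul_assoc]
    have lt_succ : ∀ {l : List ℕ}, (∀ i ∈ l, i < a) → ∀ i ∈ l, i < a + 1 :=
      fun hl i hi => (hl i hi).trans (Nat.lt_succ_self a)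
    -- If `s a` commutes with the part between its two occurrences, these become adjacent.
    have square (hc : s a * word s u = word s u * s a) : HasSquare s (a + 1) (a :: w) := by
      refine ⟨u, a, v, by omega, lt_succ hu, lt_succ hv, ?_, ?_⟩
      · simp only [List.length_cons]; omega
      · rw [word_cons, he, ← mul_assoc, ← mul_assoc, hc, mul_assoc (word s u)]
    cases a with
    | zero =>
      obtain rfl : u = [] := List.eq_nil_iff_forall_not_mem.2 fun i hi => by
        have := hu i hi; omega
      exact Or.inl (square (by simp))
    | succ b =>
      -- The part between the two occurrences of `s (b + 1)` is reduced with respect to `s b`, the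
      -- only generator in it that need not commute with `s (b + 1)`. This call lowers the first
      -- component of the termination measure, the call on the tail the second.
      rcases hasSquare_or_reduced h b (by omega) u hu with
        ⟨x, i, y, hi, hx, hy, hl', he'⟩ | hp | ⟨x, y, hx, hy, hl', he'⟩
      · refine Or.inl ⟨(b + 1) :: x, i, y ++ (b + 1) :: v, by omega, ?_, ?_, ?_, ?_⟩
        · simpa using lt_succ hx
        · intro j hj
          simp only [List.mem_append, List.mem_cons] at hj
          rcases hj with hj | rfl | hj
          exacts [lt_succ hy j hj, by omega, lt_succ hv j hj]
        · simp only [List.length_cons, List.length_append]; omega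
        · simp only [word_cons, word_append, he, he', mul_assoc]
      · exact Or.inl (square (h.comm_word fun i hi => by have := hp i hi; omega))
      -- With `u = x · s b · y` both outer letters commute inwards past `x` and `y`, and the braid
      -- relation turns `s (b + 1) · s b · s (b + 1)` into a word with a single `s (b + 1)`.
      · refine Or.inr (Or.inr ⟨x ++ [b], b :: (y ++ v), ?_, ?_, ?_, ?_⟩)
        · intro j hj
          simp only [List.mem_append, List.mem_singleton] at hj
          rcases hj with hj | rfl
          exacts [(hx j hj).trans (by omega), by omega]
        · intro j hj
          simp only [List.mem_append, List.mem_cons] at hj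
          rcases hj with rfl | hj | hj
          exacts [by omega, (hy j hj).trans (by omega), hv j hj]
        · simp only [List.length_cons, List.length_append, List.length_nil]; omega
        · have hbr := h.braid b (by omega)
          have hcx := h.comm_word (m := b + 1) (w := x) fun i hi => by have := hx i hi; omega
          have hcy := h.comm_word (m := b + 1) (w := y) fun i hi => by have := hy i hi; omega
          simp only [word_cons, word_append, he, he', word_nil, mul_one]
          calc s (b + 1) * (word s x * s b * word s y * s (b + 1) * word s v)
              = (s (b + 1) * word s x) * s b * (word s y * s (b + 1)) * word s v := by group
            _ = word s x * (s (b + 1) * s b * s (b + 1)) * word s y * word s v := by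
              rw [hcx, ← hcy]; group
            _ = _ := by rw [← hbr]; group
termination_by m _ w => (m, w.length)

/-! ### Half twists and full twists -/

/-- The product `s 0 ⋯ s (k - 1)`. -/
def up (s : ℕ → G) : ℕ → G
  | 0 => 1
  | k + 1 => up s k * s k

/-- The product `s (k - 1) ⋯ s 0`. -/
def down (s : ℕ → G) : ℕ → G
  | 0 => 1
  | k + 1 => s k * down s k

/-- The half twist on `k` strands. -/
def halfTwist (s : ℕ → G) : ℕ → G
  | 0 => 1
  | k + 1 => up s k * halfTwist s k

theorem up_succ' (s : ℕ → G) : ∀ k, up s (k + 1) = s 0 * up (fun i => s (i + 1)) k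
  | 0 => by simp [up]
  | k + 1 => by rw [up, up_succ' s k, up, mul_assoc]

theorem down_succ' (s : ℕ → G) : ∀ k, down s (k + 1) = down (fun i => s (i + 1)) k * s 0
  | 0 => by simp [down]
  | k + 1 => by rw [down, down_succ' s k, down, mul_assoc]

/-- Reversing the indices makes the outermost letters of the full turn of the last strand the first
ones, so that an induction can peel the turn from outside to inside. -/
theorem up_reverse : ∀ (m : ℕ) (s : ℕ → G), up (fun i => s (m - i)) (m + 1) = down s (m + 1)
  | 0, s => by simp [up, down]
  | m + 1, s => by
    rw [up_succ', down, ← up_reverse m s]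
    simp

theorem down_reverse : ∀ (m : ℕ) (s : ℕ → G), down (fun i => s (m - i)) (m + 1) = up s (m + 1)
  | 0, s => by simp [up, down]
  | m + 1, s => by
    rw [down_succ', up, ← down_reverse m s]
    simp

theorem up_congr {t : ℕ → G} : ∀ (k : ℕ) (_ : ∀ i < k, s i = t i), up s k = up t k
  | 0, _ => rfl
  | k + 1, h => by rw [up, up, up_congr k fun i hi => h i (by omega), h k (by omega)]

theorem down_congr {t : ℕ → G} : ∀ (k : ℕ) (_ : ∀ i < k, s i = t i), down s k = down t k
  | 0, _ => rfl
  | k + 1, h => by rw [down, down, down_congr k fun i hi => h i (by omega), h k (by omega)]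

theorem halfTwist_congr {t : ℕ → G} : ∀ (k : ℕ) (_ : ∀ i, i + 1 < k → s i = t i),
    halfTwist s k = halfTwist t k
  | 0, _ => rfl
  | k + 1, h => by
    rw [halfTwist, halfTwist, up_congr k fun i hi => h i (by omega),
      halfTwist_congr k fun i hi => h i (by omega)]

section Map

variable {H : Type*} [Group H] (φ : G →* H)

theorem map_up (s : ℕ → G) : ∀ k, φ (up s k) = up (fun i => φ (s i)) k
  | 0 => map_one φ
  | k + 1 => by rw [up, up, map_mul, map_up s k]

theorem map_down (s : ℕ → G) : ∀ k, φ (down s k) = down (fun i => φ (s i)) k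
  | 0 => map_one φ
  | k + 1 => by rw [down, down, map_mul, map_down s k]

theorem map_halfTwist (s : ℕ → G) : ∀ k, φ (halfTwist s k) = halfTwist (fun i => φ (s i)) k
  | 0 => map_one φ
  | k + 1 => by rw [halfTwist, halfTwist, map_mul, map_up, map_halfTwist s k]

theorem map_word (s : ℕ → G) (w : List ℕ) : φ (word s w) = word (fun i => φ (s i)) w := by
  induction w with
  | nil => simp
  | cons a w ih => simp [ih]

end Map

theorem word_congr {t : ℕ → G} {w : List ℕ} (h : ∀ i ∈ w, s i = t i) : word s w = word t w := by
  rw [word, word, List.map_congr_left h]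

theorem comm_up (h : BraidSequence s N) {m : ℕ} : ∀ k (_ : k < m), s m * up s k = up s k * s m
  | 0, _ => by simp [up]
  | k + 1, hk => by
    rw [up, ← mul_assoc, h.comm_up k (by omega), mul_assoc, ← h.comm k m hk, mul_assoc]

theorem comm_down (h : BraidSequence s N) {m : ℕ} :
    ∀ k (_ : k < m), s m * down s k = down s k * s m
  | 0, _ => by simp [down]
  | k + 1, hk => by
    rw [down, ← mul_assoc, ← h.comm k m hk, mul_assoc, h.comm_down k (by omega), mul_assoc]

theorem comm_halfTwist (h : BraidSequence s N) {m : ℕ} :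
    ∀ k (_ : k < m + 1), s m * halfTwist s k = halfTwist s k * s m
  | 0, _ => by simp [halfTwist]
  | k + 1, hk => by
    rw [halfTwist, ← mul_assoc, h.comm_up k (by omega), mul_assoc, h.comm_halfTwist k (by omega),
      mul_assoc]

/-- The letter slides left past the far letters, passes the pair `s i * s (i + 1)` by the braid
relation with its index raised, and then commutes with the rest. -/
theorem up_mul (h : BraidSequence s N) {i : ℕ} :
    ∀ k (_ : k ≤ N) (_ : i + 1 < k), up s k * s i = s (i + 1) * up s k
  | k + 1, hk, hi => by
    rcases (show i + 1 < k ∨ k = i + 1 by omega) with hi' | rfl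
    · rw [up, mul_assoc, ← h.comm i k hi', ← mul_assoc, h.up_mul k (by omega) hi', mul_assoc]
    · rw [up, up, mul_assoc, mul_assoc, ← mul_assoc (s i), h.braid i (by omega), mul_assoc,
        ← mul_assoc, ← h.comm_up i (by omega)]
      simp only [mul_assoc]

theorem down_mul (h : BraidSequence s N) {i : ℕ} :
    ∀ k (_ : k ≤ N) (_ : i + 1 < k), down s k * s (i + 1) = s i * down s k
  | k + 1, hk, hi => by
    rcases (show i + 1 < k ∨ k = i + 1 by omega) with hi' | rfl
    · rw [down, mul_assoc, h.down_mul k (by omega) hi', ← mul_assoc, ← h.comm i k hi', mul_assoc]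
    · rw [down, down, mul_assoc, mul_assoc, ← h.comm_down i (by omega)]
      simp only [← mul_assoc]
      rw [h.braid i (by omega)]

/-- The definition peels a factor off the left of the half twist. This mirror recursion peels one
off the right, which works because `s k` commutes with the half twist on `k` strands. -/
theorem halfTwist_succ (h : BraidSequence s N) :
    ∀ k, halfTwist s (k + 1) = halfTwist s k * down s k
  | 0 => by simp [halfTwist, up, down]
  | k + 1 => by
    calc halfTwist s (k + 2) = up s k * s k * halfTwist s (k + 1) := rfl
      _ = up s k * (s k * halfTwist s k) * down s k := by
        rw [halfTwist_succ h k]; simp only [mul_assoc]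
      _ = up s k * halfTwist s k * (s k * down s k) := by
        rw [h.comm_halfTwist k (by omega)]; simp only [mul_assoc]

/-- The half twist reflects the indices of the generators. All but the last generator are handled by
the left recursion with `up_mul`, the last one by the right recursion with `down_mul`; applied
twice, the reflection gives the centrality of the full twist. -/
theorem halfTwist_mul (h : BraidSequence s N) {i : ℕ} :
    ∀ k (_ : k ≤ N) (_ : i < k), halfTwist s (k + 1) * s i = s (k - 1 - i) * halfTwist s (k + 1)
  | k + 1, hk, hi => by
    rcases (show i < k ∨ i = k by omega) with hi' | rfl
    · rw [halfTwist, mul_assoc, h.halfTwist_mul k (by omega) hi', ← mul_assoc,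
        h.up_mul (k + 1) hk (by omega), show k - 1 - i + 1 = k + 1 - 1 - i by omega, mul_assoc]
    · cases i with
      | zero => simp [halfTwist, up]
      | succ j =>
        rw [h.halfTwist_succ, mul_assoc, h.down_mul _ hk (by omega), ← mul_assoc,
          h.halfTwist_mul (j + 1) (by omega) (by omega), mul_assoc]
        simp

/-- The full twist commutes with the generators. -/
theorem comm_fullTwist (h : BraidSequence s N) {i k : ℕ} (hk : k ≤ N) (hi : i < k) :
    s i * halfTwist s (k + 1) ^ 2 = halfTwist s (k + 1) ^ 2 * s i := by
  rw [pow_two, mul_assoc _ _ (s i), h.halfTwist_mul k hk hi, ← mul_assoc _ (s _),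
    h.halfTwist_mul k hk (by omega), show k - 1 - (k - 1 - i) = i by omega, mul_assoc]

theorem down_up_comm (h : BraidSequence s N) {i k : ℕ} (hk : k ≤ N) (hi : i + 1 < k) :
    s i * (down s k * up s k) = down s k * up s k * s i := by
  rw [mul_assoc, h.up_mul k hk hi, ← mul_assoc, ← h.down_mul k hk hi, mul_assoc]

theorem comm_up_of_forall {g : G} : ∀ (k : ℕ) (_ : ∀ i < k, g * s i = s i * g),
    g * up s k = up s k * g
  | 0, _ => by simp [up]
  | k + 1, hg => by
    rw [up, ← mul_assoc, comm_up_of_forall k fun i hi => hg i (by omega), mul_assoc,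
      hg k (by omega), mul_assoc]

theorem comm_down_of_forall {g : G} : ∀ (k : ℕ) (_ : ∀ i < k, g * s i = s i * g),
    g * down s k = down s k * g
  | 0, _ => by simp [down]
  | k + 1, hg => by
    rw [down, ← mul_assoc, hg k (by omega), mul_assoc,
      comm_down_of_forall k fun i hi => hg i (by omega), mul_assoc]

theorem comm_halfTwist_of_forall {g : G} : ∀ (k : ℕ) (_ : ∀ i, i + 1 < k → g * s i = s i * g),
    g * halfTwist s k = halfTwist s k * g
  | 0, _ => by simp [halfTwist]
  | k + 1, hg => by
    rw [halfTwist, ← mul_assoc, comm_up_of_forall k fun i hi => hg i (by omega), mul_assoc,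
      comm_halfTwist_of_forall k fun i hi => hg i (by omega), mul_assoc]

/-- The full twist on `k + 1` strands is the full twist on `k` strands followed by the full turn
of the last strand around the others. -/
theorem fullTwist_succ (h : BraidSequence s N) {k : ℕ} (hk : k ≤ N) :
    halfTwist s (k + 1) ^ 2 = halfTwist s k ^ 2 * (down s k * up s k) := by
  have hc := comm_halfTwist_of_forall (s := s) (g := down s k * up s k) k fun i hi =>
    (h.down_up_comm hk hi).symm
  rw [pow_two, pow_two, mul_assoc (halfTwist s k), ← hc]
  -- The first factor of the square is expanded on its right and the second on its left, so that
  -- `down` and `up` meet in the middle.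
  nth_rewrite 1 [h.halfTwist_succ]
  rw [halfTwist]
  simp only [mul_assoc]

/-! ### The full turn of the last strand -/

/-- Conjugating the generator `s (m - k)` by `s m ⋯ s (m - k + 1)` moves `s m` to the middle. -/
theorem exists_conj_eq (h : BraidSequence s N) {m : ℕ} (hm : m < N) {H : Subgroup G}
    (hH : ∀ i < m, s i ∈ H) : ∀ k (_ : k ≤ m), ∃ d ∈ H, ∃ d' ∈ H,
      up (fun i => s (m - i)) k * s (m - k) * down (fun i => s (m - i)) k = d * s m * d'
  | 0, _ => ⟨1, H.one_mem, 1, H.one_mem, by simp [up, down]⟩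
  | k + 1, hk => by
    obtain ⟨d, hd, d', hd', e⟩ := exists_conj_eq h hm hH k (by omega)
    have hj := hH (m - (k + 1)) (by omega)
    refine ⟨s (m - (k + 1)) * d, H.mul_mem hj hd, d' * s (m - (k + 1)), H.mul_mem hd' hj, ?_⟩
    -- The braid relation exchanges the roles of the two innermost generators. The outer copies of
    -- `s (m - (k + 1))` then commute with both arms, whose indices are larger by at least two, and
    -- the previous case remains inside.
    have hbr := h.braid (m - (k + 1)) (by omega)
    rw [show m - (k + 1) + 1 = m - k by omega] at hbr
    have hu := comm_up_of_forall (s := fun i => s (m - i)) (g := s (m - (k + 1))) k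
      fun i hi => h.comm _ _ (by omega)
    have hd := comm_down_of_forall (s := fun i => s (m - i)) (g := s (m - (k + 1))) k
      fun i hi => h.comm _ _ (by omega)
    rw [up, down]
    calc _ = up (fun i => s (m - i)) k * (s (m - k) * s (m - (k + 1)) * s (m - k)) *
          down (fun i => s (m - i)) k := by group
      _ = (up (fun i => s (m - i)) k * s (m - (k + 1))) * s (m - k) *
          (s (m - (k + 1)) * down (fun i => s (m - i)) k) := by rw [← hbr]; group
      _ = s (m - (k + 1)) * (up (fun i => s (m - i)) k * s (m - k) *
          down (fun i => s (m - i)) k) * s (m - (k + 1)) := by rw [← hu, hd]; group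
      _ = _ := by rw [e]; group

/-- A function which resolves squares and vanishes on products with one last generator does not
see the full turn of the last strand around the others. -/
theorem apply_mul_down_mul_up (h : BraidSequence s N) {m : ℕ} (hm : m < N) {H : Subgroup G}
    (hH : ∀ i < m, s i ∈ H) {K : Type*} [CommRing K] {z : K} {f : G → K}
    (hsq : ∀ (α β : G) (i : ℕ), i < m + 1 →
      f (α * (s i * s i) * β) = f (α * β) + z * f (α * s i * β))
    (hf : ∀ d ∈ H, ∀ d' ∈ H, f (d * s m * d') = 0) {g : G} (hg : g ∈ H) :
    f (g * (down s (m + 1) * up s (m + 1))) = f g := by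
  rw [← up_reverse m s, ← down_reverse m s]
  -- The turn is the case `k = m + 1` of `s m ⋯ s (m - k + 1) · s (m - k + 1) ⋯ s m`, which shrinks
  -- to `1` by resolving the square in its middle.
  suffices hk : ∀ k ≤ m + 1,
      f (g * (up (fun i => s (m - i)) k * down (fun i => s (m - i)) k)) = f g from hk _ le_rfl
  intro k
  induction k with
  | zero => simp [up, down]
  | succ k ih =>
    intro hk
    obtain ⟨d, hd, d', hd', e⟩ := h.exists_conj_eq hm hH k (by omega)
    -- Resolving the middle square leaves the shorter turn and `z` times a term with one middle
    -- letter, which by `exists_conj_eq` contains `s m` only once and is therefore killed by `f`.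
    have h1 := hsq (g * up (fun i => s (m - i)) k) (down (fun i => s (m - i)) k) (m - k) (by omega)
    have h2 := hf (g * d) (H.mul_mem hg hd) d' hd'
    rw [mul_assoc g d, mul_assoc g, ← e] at h2
    simp only [up, down, mul_assoc] at h1 h2 ih ⊢
    rw [h1, h2, ih (by omega), mul_zero, add_zero]

end BraidSequence

/-! ### Braid groups and skein functions -/

namespace BraidGroup

open BraidSequence

/-- The generators of the braid group, continued by `1`. -/
def gen (n i : ℕ) : BraidGroup n := if h : i < n - 1 then σ ⟨i, h⟩ else 1

theorem gen_of_lt {n i : ℕ} (h : i < n - 1) : gen n i = σ ⟨i, h⟩ := dif_pos h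

theorem braidSequence_gen (n : ℕ) : BraidSequence (gen n) (n - 1) where
  comm i j h := by
    by_cases hj : j < n - 1
    · rw [gen_of_lt hj, gen_of_lt (show i < n - 1 by omega)]
      exact σ_comm h
    · simp [gen, hj]
  braid i h := by
    rw [gen_of_lt h, gen_of_lt (show i < n - 1 by omega)]
    exact σ_braid rfl

theorem addStrand_gen {n i : ℕ} (h : i < n - 1) : addStrand n (gen n i) = gen (n + 1) i := by
  rw [gen_of_lt h, gen_of_lt (show i < n + 1 - 1 by omega), addStrand_σ]

theorem gen_mem_range_addStrand {n i : ℕ} (h : i < n - 1) :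
    gen (n + 1) i ∈ (addStrand n).range := ⟨gen n i, addStrand_gen h⟩

theorem addStrand_word {n : ℕ} {w : List ℕ} (hw : ∀ i ∈ w, i < n - 1) :
    addStrand n (word (gen n) w) = word (gen (n + 1)) w := by
  rw [map_word]
  exact word_congr fun i hi => addStrand_gen (hw i hi)

theorem list_ofFn_prod_eq_up {G : Type*} [Group G] (s : ℕ → G) :
    ∀ n, (List.ofFn fun i : Fin n => s i).prod = up s n
  | 0 => by simp [up]
  | n + 1 => by
    rw [List.ofFn_succ', List.concat_eq_append, List.prod_append, up, ← list_ofFn_prod_eq_up s n]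
    simp

/-- Both sides obey the same recursion. This makes the results on abstract sequences available for
the Garside element. -/
theorem garside_eq_halfTwist : ∀ n, garside n = halfTwist (gen n) n
  | 0 => rfl
  | n + 1 => by
    rw [garside, halfTwist, garside_eq_halfTwist n, map_halfTwist]
    congr 1
    · rw [← list_ofFn_prod_eq_up]
      congr 2
      funext i
      exact (gen_of_lt i.2).symm
    · exact halfTwist_congr n fun i hi => addStrand_gen (by omega)

theorem addStrand_garside (n : ℕ) : addStrand n (garside n) = halfTwist (gen (n + 1)) n := by
  rw [garside_eq_halfTwist, map_halfTwist]
  exact halfTwist_congr n fun i hi => addStrand_gen (by omega)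

theorem garside_sq_comm {n : ℕ} (β : BraidGroup n) : β * garside n ^ 2 = garside n ^ 2 * β := by
  induction β using induction_generators with
  | hσ i =>
    obtain ⟨k, rfl⟩ : ∃ k, n = k + 1 := ⟨n - 1, by have := i.2; omega⟩
    have h := (braidSequence_gen (k + 1)).comm_fullTwist (le_refl k) i.2
    rwa [gen_of_lt i.2, ← garside_eq_halfTwist] at h
  | h1 => simp
  | hmul α β hα hβ => rw [mul_assoc, hβ, ← mul_assoc, hα, mul_assoc]
  | hinv α hα => exact (Commute.inv_left hα :)

theorem garside_succ_sq (n : ℕ) : garside (n + 1) ^ 2 =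
    addStrand n (garside n ^ 2) * (down (gen (n + 1)) n * up (gen (n + 1)) n) := by
  rw [map_pow, addStrand_garside, garside_eq_halfTwist,
    (braidSequence_gen (n + 1)).fullTwist_succ (le_refl n)]

theorem eq_one_of_one (β : BraidGroup 1) : β = 1 := by
  induction β using induction_generators with
  | hσ i => exact i.elim0
  | h1 => rfl
  | hmul α β hα hβ => rw [hα, hβ, one_mul]
  | hinv α hα => rw [hα, inv_one]

theorem IsPositive.exists_word {n : ℕ} {β : BraidGroup n} (hβ : β.IsPositive) :
    ∃ w : List ℕ, (∀ i ∈ w, i < n - 1) ∧ β = word (gen n) w := by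
  induction hβ using Submonoid.closure_induction with
  | mem x hx =>
    obtain ⟨i, rfl⟩ := hx
    exact ⟨[(i : ℕ)], by simp, by simp [gen_of_lt i.2]⟩
  | one => exact ⟨[], by simp, by simp⟩
  | mul x y _ _ hx hy =>
    obtain ⟨u, hu, rfl⟩ := hx
    obtain ⟨w, hw, rfl⟩ := hy
    refine ⟨u ++ w, fun i hi => ?_, by simp⟩
    rcases List.mem_append.1 hi with hi | hi
    exacts [hu i hi, hw i hi]

/-! ### Exponent sums and skein functions -/

/-- The exponent sum, as a homomorphism. -/
def writheHom (n : ℕ) : BraidGroup n →* Multiplicative ℤ :=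
  PresentedGroup.toGroup (f := fun _ : Fin (n - 1) => Multiplicative.ofAdd (1 : ℤ)) (by
    rintro r (⟨i, j, h, rfl⟩ | ⟨i, j, h, rfl⟩) <;> simp)

/-- The writhe of a closed braid: the exponent sum. -/
def writhe {n : ℕ} (β : BraidGroup n) : ℤ := (writheHom n β).toAdd

@[simp] theorem writhe_σ {n : ℕ} (i : Fin (n - 1)) : writhe (σ i : BraidGroup n) = 1 := by
  simp [writhe, writheHom, σ]

@[simp] theorem writhe_mul {n : ℕ} (α β : BraidGroup n) : writhe (α * β) = writhe α + writhe β := by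
  simp [writhe]

@[simp] theorem writhe_inv {n : ℕ} (α : BraidGroup n) : writhe α⁻¹ = -writhe α := by
  simp [writhe]

@[simp] theorem writhe_one {n : ℕ} : writhe (1 : BraidGroup n) = 0 := by
  simp [writhe]

@[simp] theorem writhe_addStrand {n : ℕ} (α : BraidGroup n) :
    writhe (addStrand n α) = writhe α := by
  induction α using induction_generators with
  | hσ i => rw [addStrand_σ, writhe_σ, writhe_σ]
  | h1 => simp
  | hmul α β hα hβ => simp [hα, hβ]
  | hinv α hα => simp [hα]

/-- A function on the braid group satisfying the framed Homfly skein relation. -/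
def IsSkein {n : ℕ} {K : Type*} [CommRing K] (z : K) (f : BraidGroup n → K) : Prop :=
  ∀ (α β : BraidGroup n) (i : Fin (n - 1)), f (α * σ i * β) - f (α * (σ i)⁻¹ * β) = z * f (α * β)

namespace IsSkein

variable {n : ℕ} {K : Type*} [CommRing K] {z : K} {f g : BraidGroup n → K}

theorem mul_left (hf : IsSkein z f) (γ : BraidGroup n) : IsSkein z fun β => f (γ * β) :=
  fun α β i => by simpa [mul_assoc] using hf (γ * α) β i

theorem mul_right (hf : IsSkein z f) (γ : BraidGroup n) : IsSkein z fun β => f (β * γ) :=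
  fun α β i => by simpa [mul_assoc] using hf α (β * γ) i

theorem sub_const_mul (hf : IsSkein z f) (hg : IsSkein z g) (c : K) :
    IsSkein z fun β => f β - c * g β :=
  fun α β i => by linear_combination hf α β i - c * hg α β i

/-- This is the skein relation at the second of the two equal crossings. -/
theorem apply_sq (hf : IsSkein z f) (α β : BraidGroup n) {i : ℕ} (hi : i < n - 1) :
    f (α * (gen n i * gen n i) * β) = f (α * β) + z * f (α * gen n i * β) := by
  have h := hf (α * σ ⟨i, hi⟩) β ⟨i, hi⟩
  rw [mul_inv_cancel_right] at h
  rw [gen_of_lt hi, ← mul_assoc]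
  linear_combination h

/-- A skein function which vanishes on positive words vanishes. -/
theorem eq_zero_of_word (hf : IsSkein z f)
    (h : ∀ w : List ℕ, (∀ i ∈ w, i < n - 1) → f (word (gen n) w) = 0) (β : BraidGroup n) :
    f β = 0 := by
  -- Quantifying over all skein functions lets the induction pass to translates of `f`; treating `β`
  -- and `β⁻¹` together makes the claim stable under inversion.
  suffices H : (∀ f : BraidGroup n → K, IsSkein z f → (∀ γ : BraidGroup n, γ.IsPositive → f γ = 0) →
      f β = 0) ∧ (∀ f : BraidGroup n → K, IsSkein z f →
      (∀ γ : BraidGroup n, γ.IsPositive → f γ = 0) → f β⁻¹ = 0) by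
    refine H.1 f hf fun γ hγ => ?_
    obtain ⟨w, hw, rfl⟩ := hγ.exists_word
    exact h w hw
  -- The translate `γ ↦ f (γ * β)` vanishes on positive `γ`, since for each of these `δ ↦ f (γ * δ)`
  -- vanishes on positive braids, hence at `β`.
  have mul {α β : BraidGroup n}
      (hα : ∀ f : BraidGroup n → K, IsSkein z f → (∀ γ : BraidGroup n, γ.IsPositive → f γ = 0) →
        f α = 0)
      (hβ : ∀ f : BraidGroup n → K, IsSkein z f → (∀ γ : BraidGroup n, γ.IsPositive → f γ = 0) →
        f β = 0) (f : BraidGroup n → K) (hf : IsSkein z f)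
      (h : ∀ γ : BraidGroup n, γ.IsPositive → f γ = 0) : f (α * β) = 0 :=
    hα _ (hf.mul_right β) fun γ hγ => hβ _ (hf.mul_left γ) fun δ hδ =>
      h _ (Submonoid.mul_mem _ hγ hδ)
  have posσ (i : Fin (n - 1)) : (σ i : BraidGroup n).IsPositive :=
    Submonoid.subset_closure ⟨i, rfl⟩
  have posOne : (1 : BraidGroup n).IsPositive := Submonoid.one_mem _
  induction β using induction_generators with
  | hσ i =>
    refine ⟨fun f _ h => h _ (posσ i), fun f hf h => ?_⟩
    have e := hf 1 1 i
    simp only [one_mul, mul_one, h _ (posσ i), h _ posOne] at e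
    linear_combination -e
  | h1 => exact ⟨fun f _ h => h _ posOne, fun f _ h => by simpa using h _ posOne⟩
  | hmul α β hα hβ =>
    exact ⟨mul hα.1 hβ.1, fun f hf h => by
      rw [mul_inv_rev]
      exact mul hβ.2 hα.2 f hf h⟩
  | hinv α hα => exact ⟨hα.2, fun f hf h => by rw [inv_inv]; exact hα.1 f hf h⟩

end IsSkein

/-- A conjugation invariant skein function on `n + 1` strands which vanishes on braids in which the
last generator occurs at most once vanishes. -/
theorem IsSkein.eq_zero_of_addStrand {n : ℕ} {K : Type*} [CommRing K] {z : K}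
    {f : BraidGroup (n + 1 + 1) → K} (hf : IsSkein z f) (hc : ∀ α β, f (α * β) = f (β * α))
    (h0 : ∀ α : BraidGroup (n + 1), f (addStrand _ α) = 0)
    (h1 : ∀ α : BraidGroup (n + 1), f (addStrand _ α * gen _ n) = 0)
    (β : BraidGroup (n + 1 + 1)) : f β = 0 := by
  refine hf.eq_zero_of_word (fun w hw => ?_) β
  induction hl : w.length using Nat.strong_induction_on generalizing w with
  | _ l ih =>
    subst hl
    -- A square resolves into words shorter by two letters and by one. Without a square, the last
    -- generator is absent, or occurs once and is moved to the end by conjugation.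
    rcases (braidSequence_gen (n + 1 + 1)).hasSquare_or_reduced n (by omega) w hw with
      ⟨u, i, v, hi, hu, hv, hl, e⟩ | hp | ⟨u, v, hu, hv, hl, e⟩
    · have huv : ∀ j ∈ u ++ v, j < n + 1 := fun j hj => (List.mem_append.1 hj).elim (hu j) (hv j)
      have huiv : ∀ j ∈ u ++ i :: v, j < n + 1 := fun j hj => by
        simp only [List.mem_append, List.mem_cons] at hj
        rcases hj with hj | rfl | hj
        exacts [hu j hj, hi, hv j hj]
      have e1 := ih _ (by rw [List.length_append]; omega) (u ++ v) huv rfl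
      have e2 := ih _ (by rw [List.length_append, List.length_cons]; omega) (u ++ i :: v) huiv rfl
      rw [word_append] at e1
      rw [word_append, word_cons, ← mul_assoc] at e2
      rw [e, hf.apply_sq _ _ hi, e1, e2, mul_zero, add_zero]
    · rw [← addStrand_word (n := n + 1) hp]
      exact h0 _
    · rw [e, hc, ← mul_assoc, ← addStrand_word (n := n + 1) hv, ← addStrand_word (n := n + 1) hu, ← map_mul]
      exact h1 _

end BraidGroup

/-! ### Columns of Laurent polynomials -/

namespace LaurentVZ

@[simp] theorem column_v_mul (P : LaurentVZ) (j k : ℤ) : (v j * P).column k = P.column (k - j) := by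
  rw [column, v, LaurentPolynomial.T, AddMonoidAlgebra.coeff_single_mul_apply, one_mul, column,
    neg_add_eq_sub]

@[simp] theorem column_z_mul (P : LaurentVZ) (j k : ℤ) :
    (z j * P).column k = LaurentPolynomial.T j * P.column k := by
  rw [column, z, ← LaurentPolynomial.single_eq_C, AddMonoidAlgebra.coeff_single_mul_apply, neg_zero,
    zero_add, column]

@[simp] theorem column_sub (P Q : LaurentVZ) (k : ℤ) :
    (P - Q).column k = P.column k - Q.column k := rfl

theorem column_one (k : ℤ) : column 1 k = if k = 0 then 1 else 0 := by
  rw [← LaurentPolynomial.T_zero, column, LaurentPolynomial.T_apply]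
  exact if_congr eq_comm rfl rfl

theorem ne_zero_of_column {P : LaurentVZ} {k : ℤ} (h : P.column k ≠ 0) : P ≠ 0 := by
  rintro rfl
  exact h rfl

theorem leftColumn_eq {P : LaurentVZ} {k : ℤ} (h : P.column k ≠ 0)
    (hl : ∀ j < k, P.column j = 0) : P.leftColumn = P.column k := by
  have hk : k ∈ P.coeff.support := Finsupp.mem_support_iff.2 h
  rw [leftColumn, dif_pos ⟨k, hk⟩]
  congr 1
  refine le_antisymm (Finset.min'_le _ _ hk) (Finset.le_min' _ _ _ fun j hj => ?_)
  by_contra hjk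
  exact Finsupp.mem_support_iff.1 hj (hl j (not_le.1 hjk))

theorem rightColumn_eq {P : LaurentVZ} {k : ℤ} (h : P.column k ≠ 0)
    (hr : ∀ j, k < j → P.column j = 0) : P.rightColumn = P.column k := by
  have hk : k ∈ P.coeff.support := Finsupp.mem_support_iff.2 h
  rw [rightColumn, dif_pos ⟨k, hk⟩]
  congr 1
  refine le_antisymm (Finset.max'_le _ _ _ fun j hj => ?_) (Finset.le_max' _ _ hk)
  by_contra hjk
  exact Finsupp.mem_support_iff.1 hj (hr j (not_le.1 hjk))

end LaurentVZ

/-! ### The columns of the framed Homfly polynomial -/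

namespace BraidGroup

open BraidSequence LaurentPolynomial

theorem closure_conj {n : ℕ} (hn : 0 < n) (α β : BraidGroup n) :
    closure hn (α * β) = closure hn (β * α) :=
  Quot.sound (.conj hn α β)

theorem closure_stabPos {n : ℕ} (α : BraidGroup (n + 1)) :
    closure (Nat.succ_pos _) (addStrand _ α * σ ⟨n, Nat.lt_succ_self n⟩) =
      closure (Nat.succ_pos n) α :=
  Quot.sound (.stabPos _ α)

theorem closure_stabNeg {n : ℕ} (α : BraidGroup (n + 1)) :
    closure (Nat.succ_pos _) (addStrand _ α * (σ ⟨n, Nat.lt_succ_self n⟩)⁻¹) =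
      closure (Nat.succ_pos n) α :=
  Quot.sound (.stabNeg _ α)

/-- The coefficient of `v ^ e` in the framed Homfly polynomial `v ^ (-w) P` of a closed braid. -/
noncomputable def framedColumn (n : ℕ) (e : ℤ) (β : BraidGroup (n + 1)) : LaurentPolynomial ℤ :=
  (homfly (closure n.succ_pos β)).column (writhe β + e)

theorem framedColumn_conj (n : ℕ) (e : ℤ) (α β : BraidGroup (n + 1)) :
    framedColumn n e (α * β) = framedColumn n e (β * α) := by
  rw [framedColumn, framedColumn, closure_conj, writhe_mul, writhe_mul, add_comm (writhe α)]

/-- The factors `v⁻¹` and `v` shift the columns by exactly the change of the writhe at the crossing.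
-/
theorem framedColumn_isSkein (n : ℕ) (e : ℤ) : IsSkein (T 1) (framedColumn n e) := by
  intro α β i
  have h := congrArg (fun P => LaurentVZ.column P (writhe (α * β) + e))
    (homfly_isHomfly.skein n.succ_pos α β i)
  simp only [LaurentVZ.column_sub, LaurentVZ.column_v_mul, LaurentVZ.column_z_mul] at h
  rw [framedColumn, framedColumn, framedColumn, ← h]
  simp only [writhe_mul, writhe_σ, writhe_inv]
  congr 2 <;> ring

theorem framedColumn_mul_σ (n : ℕ) (e : ℤ) (α : BraidGroup (n + 1)) :
    framedColumn (n + 1) e (addStrand _ α * σ ⟨n, Nat.lt_succ_self n⟩) =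
      framedColumn n (e + 1) α := by
  rw [framedColumn, framedColumn, closure_stabPos, writhe_mul, writhe_σ, writhe_addStrand,
    add_assoc, add_comm 1 e]

theorem framedColumn_mul_σ_inv (n : ℕ) (e : ℤ) (α : BraidGroup (n + 1)) :
    framedColumn (n + 1) e (addStrand _ α * (σ ⟨n, Nat.lt_succ_self n⟩)⁻¹) =
      framedColumn n (e - 1) α := by
  rw [framedColumn, framedColumn, closure_stabNeg, writhe_mul, writhe_inv, writhe_σ,
    writhe_addStrand, add_assoc, neg_add_eq_sub]

/-- Skein relation at a crossing between the free strand and its neighbour: either sign of the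
crossing is a stabilization. The factor `z` stays on the left and is cancelled later as a unit. -/
theorem framedColumn_addStrand (n : ℕ) (e : ℤ) (α : BraidGroup (n + 1)) :
    T 1 * framedColumn (n + 1) e (addStrand _ α) =
      framedColumn n (e + 1) α - framedColumn n (e - 1) α := by
  have h := framedColumn_isSkein (n + 1) e (addStrand _ α) 1 ⟨n, Nat.lt_succ_self n⟩
  rw [mul_one, mul_one, mul_one, framedColumn_mul_σ, framedColumn_mul_σ_inv] at h
  exact h.symm

theorem framedColumn_zero (e : ℤ) (β : BraidGroup 1) :
    framedColumn 0 e β = if e = 0 then 1 else 0 := by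
  rw [eq_one_of_one β, framedColumn, homfly_isHomfly.unknot, writhe_one, zero_add,
    LaurentVZ.column_one]

theorem eq_zero_of_T_mul {p : LaurentPolynomial ℤ} {k : ℤ} (h : T k * p = 0) : p = 0 :=
  (isUnit_T k).mul_right_eq_zero.1 h

/-- The bounds of Morton and Franks–Williams. -/
theorem framedColumn_eq_zero : ∀ (n : ℕ) (e : ℤ) (_ : (n : ℤ) < |e|) (β : BraidGroup (n + 1)),
    framedColumn n e β = 0
  | 0, e, he, β => by
    rw [framedColumn_zero, if_neg]
    rintro rfl
    simp at he
  | n + 1, e, he, β => by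
    -- Removing a strand changes `e` by one and the bound by one, so both neighbours of `e` are
    -- still out of range.
    have h1 : (n : ℤ) < |e + 1| := by
      push_cast at he; rw [lt_abs] at he ⊢; omega
    have h2 : (n : ℤ) < |e - 1| := by
      push_cast at he; rw [lt_abs] at he ⊢; omega
    refine (framedColumn_isSkein _ e).eq_zero_of_addStrand (framedColumn_conj _ e) (fun α => ?_)
      (fun α => ?_) β
    · refine eq_zero_of_T_mul (k := 1) ?_
      rw [framedColumn_addStrand, framedColumn_eq_zero n _ h1, framedColumn_eq_zero n _ h2,
        sub_zero]
    · rw [gen_of_lt (show n < n + 1 + 1 - 1 by omega), framedColumn_mul_σ,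
        framedColumn_eq_zero n _ h1]

/-! ### The extreme columns and the full twist -/

theorem framedColumn_top_addStrand (n : ℕ) (α : BraidGroup (n + 1)) :
    T 1 * framedColumn (n + 1) (n + 1) (addStrand _ α) = -framedColumn n n α := by
  rw [framedColumn_addStrand, framedColumn_eq_zero n _ (by rw [lt_abs]; omega), zero_sub,
    add_sub_cancel_right]

theorem framedColumn_bot_addStrand (n : ℕ) (α : BraidGroup (n + 1)) :
    T 1 * framedColumn (n + 1) (-(n + 1)) (addStrand _ α) = framedColumn n (-n) α := by
  rw [framedColumn_addStrand, framedColumn_eq_zero n (-(n + 1) - 1) (by rw [lt_abs]; omega),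
    sub_zero, neg_add, neg_add_cancel_right]

theorem framedColumn_top_mul_σ (n : ℕ) (α : BraidGroup (n + 1)) :
    framedColumn (n + 1) (n + 1) (addStrand _ α * σ ⟨n, Nat.lt_succ_self n⟩) = 0 := by
  rw [framedColumn_mul_σ, framedColumn_eq_zero n _ (by rw [lt_abs]; omega)]

theorem framedColumn_bot_mul_σ (n : ℕ) (α : BraidGroup (n + 1)) :
    framedColumn (n + 1) (-(n + 1)) (addStrand _ α * σ ⟨n, Nat.lt_succ_self n⟩) =
      framedColumn n (-n) α := by
  rw [framedColumn_mul_σ, neg_add, neg_add_cancel_right]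

theorem framedColumn_bot_mul_σ_inv (n : ℕ) (α : BraidGroup (n + 1)) :
    framedColumn (n + 1) (-(n + 1)) (addStrand _ α * (σ ⟨n, Nat.lt_succ_self n⟩)⁻¹) = 0 := by
  rw [framedColumn_mul_σ_inv, framedColumn_eq_zero n _ (by rw [lt_abs]; omega)]

/-- The full twist differs from that on one strand fewer by a full turn of the last strand, which
the top column ignores: it resolves squares, and a braid with a single last generator is conjugate
to a positive stabilization, where it vanishes. -/
theorem framedColumn_top_fullTwist (n : ℕ) (α : BraidGroup (n + 1)) :
    framedColumn (n + 1) (n + 1) (addStrand _ α * garside (n + 1 + 1) ^ 2) =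
      framedColumn (n + 1) (n + 1) (addStrand _ (α * garside (n + 1) ^ 2)) := by
  rw [garside_succ_sq, ← mul_assoc, ← map_mul]
  refine (braidSequence_gen (n + 1 + 1)).apply_mul_down_mul_up (m := n) (by omega)
    (H := (addStrand (n + 1)).range) (z := T 1) (f := framedColumn (n + 1) (n + 1))
    (fun i hi => gen_mem_range_addStrand (by omega))
    (fun α β i hi => (framedColumn_isSkein _ _).apply_sq α β (by omega)) ?_ ⟨_, rfl⟩
  rintro _ ⟨d, rfl⟩ _ ⟨d', rfl⟩
  rw [framedColumn_conj, ← mul_assoc, ← map_mul, gen_of_lt (show n < n + 1 + 1 - 1 by omega),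
    framedColumn_top_mul_σ]

/-- By centrality the inverse generator can be moved behind the full twist, where it cancels the
final letter of the full turn. A single positive last generator remains, so after conjugation the
top column vanishes. -/
theorem framedColumn_top_σ_inv_fullTwist (n : ℕ) (α : BraidGroup (n + 1)) :
    framedColumn (n + 1) (n + 1)
      (addStrand _ α * (σ ⟨n, Nat.lt_succ_self n⟩)⁻¹ * garside (n + 1 + 1) ^ 2) = 0 := by
  have hd : ∃ δ, down (gen (n + 1 + 1)) n * up (gen (n + 1 + 1)) n = addStrand (n + 1) δ :=
    ⟨down (gen (n + 1)) n * up (gen (n + 1)) n, by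
      rw [map_mul, map_up, map_down, up_congr n fun i hi => addStrand_gen (n := n + 1) hi,
        down_congr n fun i hi => addStrand_gen (n := n + 1) hi]⟩
  obtain ⟨δ, hδ⟩ := hd
  have e : addStrand _ α * (σ ⟨n, Nat.lt_succ_self n⟩)⁻¹ * garside (n + 1 + 1) ^ 2 =
      addStrand _ (α * garside (n + 1) ^ 2) * (σ ⟨n, Nat.lt_succ_self n⟩ * addStrand _ δ) := by
    rw [mul_assoc, garside_sq_comm, garside_succ_sq, down, up, ← hδ,
      gen_of_lt (show n < n + 1 + 1 - 1 by omega), map_mul]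
    group
  rw [e, ← mul_assoc, framedColumn_conj, ← mul_assoc, ← map_mul, framedColumn_top_mul_σ]

/-- Kálmán's theorem for the extreme columns of the framed Homfly polynomial. -/
theorem framedColumn_bot_eq : ∀ (n : ℕ) (β : BraidGroup (n + 1)),
    framedColumn n (-n) β = (-1) ^ n * framedColumn n n (β * garside (n + 1) ^ 2)
  | 0, β => by simp [framedColumn_zero]
  | n + 1, β => by
    -- The difference of the two sides is a skein function of `β`, so it needs checking only on `α`
    -- and `α σ` with `α` on one strand fewer.
    have hs : IsSkein (T 1) fun β => framedColumn (n + 1) (-(n + 1)) β -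
        (-1) ^ (n + 1) * framedColumn (n + 1) (n + 1) (β * garside (n + 1 + 1) ^ 2) :=
      (framedColumn_isSkein _ _).sub_const_mul ((framedColumn_isSkein _ _).mul_right _) _
    have h0 (α : BraidGroup (n + 1)) : framedColumn (n + 1) (-(n + 1)) (addStrand _ α) -
        (-1) ^ (n + 1) *
          framedColumn (n + 1) (n + 1) (addStrand _ α * garside (n + 1 + 1) ^ 2) = 0 := by
      refine eq_zero_of_T_mul (k := 1) ?_
      rw [framedColumn_top_fullTwist, mul_sub, framedColumn_bot_addStrand, mul_left_comm,
        framedColumn_top_addStrand, framedColumn_bot_eq n]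
      ring
    have key := hs.eq_zero_of_addStrand (fun α γ => ?_) h0 (fun α => ?_) β
    · push_cast
      exact sub_eq_zero.1 key
    -- Conjugation invariance of the second term uses that the full twist is central.
    · rw [framedColumn_conj, mul_assoc α, garside_sq_comm, ← mul_assoc, framedColumn_conj _ _ _ γ,
        ← mul_assoc]
    -- The value at `α σ` is reached through `α σ⁻¹`, where both terms vanish separately; the
    -- smoothing `α` is covered by `h0`.
    · have h := hs (addStrand _ α) 1 ⟨n, Nat.lt_succ_self n⟩
      simp only [mul_one] at h
      rw [h0, framedColumn_bot_mul_σ_inv, framedColumn_top_σ_inv_fullTwist] at h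
      rw [gen_of_lt (show n < n + 1 + 1 - 1 by omega)]
      simpa using h

/-! ### Non-vanishing for positive braids -/

/-- Evaluation of a Laurent polynomial at `1`. -/
noncomputable def evalOne : LaurentPolynomial ℤ →+* ℤ := eval₂ (RingHom.id ℤ) 1

theorem evalOne_T (k : ℤ) : evalOne (T k) = 1 := by simp [evalOne]

/-- At `z = 1` a square gives the sum of two smaller cases, and removing a strand, free or
positively stabilized, leaves the value unchanged. No signs occur, so positivity propagates from the
value `1` on one strand. -/
theorem evalOne_framedColumn_pos : ∀ (n : ℕ) (w : List ℕ) (_ : ∀ i ∈ w, i < n),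
    0 < evalOne (framedColumn n (-n) (word (gen (n + 1)) w))
  | 0, w, _ => by simp [framedColumn_zero]
  | n + 1, w, hw => by
    induction hl : w.length using Nat.strong_induction_on generalizing w with
    | _ l ih =>
      subst hl
      push_cast at ih ⊢
      rcases (braidSequence_gen (n + 1 + 1)).hasSquare_or_reduced n (by omega) w hw with
        ⟨u, i, v, hi, hu, hv, hl, e⟩ | hp | ⟨u, v, hu, hv, hl, e⟩
      · have huv : ∀ j ∈ u ++ v, j < n + 1 := fun j hj => (List.mem_append.1 hj).elim (hu j) (hv j)
        have huiv : ∀ j ∈ u ++ i :: v, j < n + 1 := fun j hj => by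
          simp only [List.mem_append, List.mem_cons] at hj
          rcases hj with hj | rfl | hj
          exacts [hu j hj, hi, hv j hj]
        have e1 := ih _ (by rw [List.length_append]; omega) (u ++ v) huv rfl
        have e2 := ih _ (by rw [List.length_append, List.length_cons]; omega) (u ++ i :: v) huiv rfl
        rw [word_append] at e1
        rw [word_append, word_cons, ← mul_assoc] at e2
        rw [e, (framedColumn_isSkein _ _).apply_sq _ _ hi, map_add, map_mul, evalOne_T, one_mul]
        exact add_pos e1 e2
      · have h := congrArg evalOne (framedColumn_bot_addStrand n (word (gen (n + 1)) w))
        rw [map_mul, evalOne_T, one_mul, addStrand_word (n := n + 1) hp] at h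
        rw [h]
        exact evalOne_framedColumn_pos n w hp
      · rw [e, framedColumn_conj, ← mul_assoc, ← addStrand_word (n := n + 1) hv, ← addStrand_word (n := n + 1) hu, ← map_mul,
          gen_of_lt (show n < n + 1 + 1 - 1 by omega), framedColumn_bot_mul_σ, ← word_append]
        exact evalOne_framedColumn_pos n (v ++ u) fun j hj =>
          (List.mem_append.1 hj).elim (hv j) (hu j)

theorem IsPositive.framedColumn_ne_zero {n : ℕ} {β : BraidGroup (n + 1)} (hβ : β.IsPositive) :
    framedColumn n (-n) β ≠ 0 := by
  obtain ⟨w, hw, rfl⟩ := hβ.exists_word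
  intro h
  have := evalOne_framedColumn_pos n w hw
  simp [h] at this

/-- All columns further left vanish by the Morton–Franks–Williams bounds, so a non-zero column at
the bound is the outermost one. -/
theorem leftColumn_homfly {n : ℕ} {β : BraidGroup (n + 1)} (h : framedColumn n (-n) β ≠ 0) :
    (homfly (closure n.succ_pos β)).leftColumn = framedColumn n (-n) β := by
  refine LaurentVZ.leftColumn_eq h fun j hj => ?_
  have := framedColumn_eq_zero n (j - writhe β) (by rw [lt_abs]; omega) β
  rwa [framedColumn, add_sub_cancel] at this

theorem rightColumn_homfly {n : ℕ} {β : BraidGroup (n + 1)} (h : framedColumn n n β ≠ 0) :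
    (homfly (closure n.succ_pos β)).rightColumn = framedColumn n n β := by
  refine LaurentVZ.rightColumn_eq h fun j hj => ?_
  have := framedColumn_eq_zero n (j - writhe β) (by rw [lt_abs]; omega) β
  rwa [framedColumn, add_sub_cancel] at this

end BraidGroup

theorem mainTheorem4 (n : ℕ) (hn : 0 < n) (β : BraidGroup n) (hβ : β.IsPositive) :
    homfly (BraidGroup.closure hn β) ≠ 0 ∧
    homfly (BraidGroup.closure hn (β * BraidGroup.garside n ^ 2)) ≠ 0 ∧
    (homfly (BraidGroup.closure hn β)).leftColumn =
      (-1) ^ (n - 1) *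
        (homfly (BraidGroup.closure hn (β * BraidGroup.garside n ^ 2))).rightColumn := by
  obtain ⟨m, rfl⟩ : ∃ m, n = m + 1 := ⟨n - 1, by omega⟩
  have hl := hβ.framedColumn_ne_zero
  have e := BraidGroup.framedColumn_bot_eq m β
  -- Attainment of the upper bound by `β Δ²` is inferred from the identity and attainment of the
  -- lower bound by `β`.
  have hr : BraidGroup.framedColumn m m (β * BraidGroup.garside (m + 1) ^ 2) ≠ 0 := by
    intro h
    rw [h, mul_zero] at e
    exact hl e
  refine ⟨LaurentVZ.ne_zero_of_column hl, LaurentVZ.ne_zero_of_column hr, ?_⟩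
  rw [BraidGroup.leftColumn_homfly hl, BraidGroup.rightColumn_homfly hr, e]
  rfl
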